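/- Let $-\infty<a<b<\infty$, $d\in\{1,2,\dots\}$, $K,L\in(0,\infty)$, $\varrho\in(0,1]$, $p\in[2,\infty)$. Let $\|x\|=\sum_{k=1}^d|x_k|$ on $\mathbb{R}^d$, let $B(x,r)$ be the closed ball of center $x$ and radius $r$, and put $$R_1=(K+2)e^{(K+1)(b-a)}+K-1,\qquad R_2=K(1+b-a)e^{K(b-a)}+K,\qquad R_0=\max\{R_1,R_2\}.$$ Let $F^{\varrho}_{R_0}$ be the class of pairs $(\eta,f)$ with $\eta\in\mathbb{R}^d$, $\|\eta\|\le K$, and $f\colon[a,b]\times\mathbb{R}^d\to\mathbb{R}^d$ continuous such that $\|f(t,x)\|\le K(1+\|x\|)$ for all $t\in[a,b]$, $x\in\mathbb{R}^d$; $\|f(t,x)-f(s,x)\|\le L|t-s|^{\varrho}$ for all $t,s\in[a,b]$, $x\in B(\eta,R_0)$; and $\|f(t,x)-f(t,y)\|\le L\|x-y\|$ for all $t\in[a,b]$, $x,y\in B(\eta,R_0)$. For $\delta\in[0,1]$ let $\mathcal{K}_1(\delta)$ be the set of Borel measurable $\tilde\delta\colon[a,b]\times\mathbb{R}^d\to\mathbb{R}^d$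 with $\|\tilde\delta(t,y)\|\le\delta(1+\|y\|)$ for all $t\in[a,b]$, $y\in\mathbb{R}^d$, and let $V^1_{(\eta,f)}(\delta)$ be the set of pairs $(\tilde\eta,\tilde f)$ with $\tilde\eta\in B(\eta,\delta)$ and $\tilde f=f+\tilde\delta$ for some $\tilde\delta\in\mathcal{K}_1(\delta)$. For $n\in\{1,2,\dots\}$ let $h=\frac{b-a}{n}$, $t_j=a+jh$ for $0\le j\le n$, and $\theta_j=t_{j-1}+\tau_jh$ for $1\le j\le n$, where $\tau_1,\dots,\tau_n$ are independent random variables, uniformly distributed on $(0,1)$, on some probability space. The randomized explicit Euler scheme is $$\bar V^0=\tilde\eta,\qquad \bar V^j=\bar V^{j-1}+h\,\tilde f(\theta_j,\bar V^{j-1}),\quad 1\le j\le n,$$ and its output is the piecewise linear function $\bar l^{EE}\colon[a,b]\to\mathbb{R}^d$, $$\bar l^{EE}(t)=\frac{\bar V^j-\bar V^{j-1}}{h}(t-t_{j-1})+\bar V^{j-1}\quad\text{for }t\in[t_{j-1},t_j],\ 1\le j\le n.$$ **Theorem.** There is a constant $C>0$ depending only on $a,b,d,K,L,\varrho,p$ such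 that for every $(\eta,f)\in F^{\varrho}_{R_0}$ the problem $z'(t)=f(t,z(t))$, $t\in[a,b]$, $z(a)=\eta$, has a unique solution $z$ on $[a,b]$, and for all integers $n\ge\lfloor b-a\rfloor+1$, all $\delta\in[0,1]$ and all $(\tilde\eta,\tilde f)\in V^1_{(\eta,f)}(\delta)$ the error $\sup_{a\le t\le b}\|z(t)-\bar l^{EE}(t)\|$ is measurable up to a null set and $$\Bigl(\mathbb{E}\sup_{a\le t\le b}\bigl\|z(t)-\bar l^{EE}(t)\bigr\|^p\Bigr)^{1/p}\le C\Bigl(h^{\min\{\varrho+\frac12,1\}}+\delta\Bigr).$$ -/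

import Mathlib

open Set MeasureTheory ProbabilityTheory
open scoped ENNReal

noncomputable section

namespace RandEuler

/-- `ℝ^d` with the one norm `‖x‖ = ∑ k, |x k|`. -/
abbrev Vec (d : ℕ) : Type := PiLp 1 (fun _ : Fin d => ℝ)

/-- The class of pairs `(η, f)` with radius `R` and parameters `a, b, d, ϱ, K, L`.
The right-hand side is a function on `[a,b] × ℝ^d`; it is represented by a function on
`ℝ × ℝ^d` of which only the values at times in `[a,b]` are constrained. -/
structure IVPClass (a b ϱ K L R : ℝ) {d : ℕ} (η : Vec d) (f : ℝ → Vec d → Vec d) : Prop where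
  norm_init : ‖η‖ ≤ K
  continuousOn : ContinuousOn (fun q : ℝ × Vec d => f q.1 q.2) (Icc a b ×ˢ univ)
  growth : ∀ t ∈ Icc a b, ∀ x, ‖f t x‖ ≤ K * (1 + ‖x‖)
  holder : ∀ t ∈ Icc a b, ∀ s ∈ Icc a b, ∀ x ∈ Metric.closedBall η R,
    ‖f t x - f s x‖ ≤ L * |t - s| ^ ϱ
  lipschitz : ∀ t ∈ Icc a b, ∀ x ∈ Metric.closedBall η R, ∀ y ∈ Metric.closedBall η R,
    ‖f t x - f t y‖ ≤ L * ‖x - y‖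

/-- Noise functions on `[a,b] × ℝ^d` that are Borel measurable and of linear growth with
precision parameter `δ`. Only the values at times in `[a,b]` matter. -/
structure NoiseClass (a b δ : ℝ) {d : ℕ} (e : ℝ → Vec d → Vec d) : Prop where
  measurable : Measurable
    ((Icc a b ×ˢ (univ : Set (Vec d))).domRestrict (fun q : ℝ × Vec d => e q.1 q.2))
  growth : ∀ t ∈ Icc a b, ∀ y, ‖e t y‖ ≤ δ * (1 + ‖y‖)

/-- `(η', f')` is admissible inexact information about `(η, f)` with precision `δ`. -/
def InexactInfo (a b δ : ℝ) {d : ℕ} (η : Vec d) (f : ℝ → Vec d → Vec d)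
    (η' : Vec d) (f' : ℝ → Vec d → Vec d) : Prop :=
  η' ∈ Metric.closedBall η δ ∧
    ∃ e : ℝ → Vec d → Vec d, NoiseClass a b δ e ∧ ∀ t ∈ Icc a b, ∀ y, f' t y = f t y + e t y

/-- `z` solves `z' = f(t, z)` on `[a,b]`, `z(a) = η` (one-sided derivatives at the end points). -/
def IsSolution (a b : ℝ) {d : ℕ} (η : Vec d) (f : ℝ → Vec d → Vec d) (z : ℝ → Vec d) : Prop :=
  z a = η ∧ ∀ t ∈ Icc a b, HasDerivWithinAt z (f t (z t)) (Icc a b) t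

/-- Step size. -/
def step (a b : ℝ) (n : ℕ) : ℝ := (b - a) / n

/-- Grid points `t_j = a + j h`. -/
def node (a b : ℝ) (n j : ℕ) : ℝ := a + j * step a b n

/-- Evaluation points `θ_j = t_{j-1} + τ_j h`, `j ≥ 1`. -/
def evalPoint (a b : ℝ) (n : ℕ) (τ : ℕ → ℝ) (j : ℕ) : ℝ :=
  node a b n (j - 1) + τ j * step a b n

/-- The randomized explicit Euler recurrence, for one realization `τ` of the random numbers. -/
def eulerSeq (a b : ℝ) (n : ℕ) {d : ℕ} (η' : Vec d) (f' : ℝ → Vec d → Vec d) (τ : ℕ → ℝ) :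
    ℕ → Vec d
  | 0 => η'
  | j + 1 => eulerSeq a b n η' f' τ j +
      step a b n • f' (evalPoint a b n τ (j + 1)) (eulerSeq a b n η' f' τ j)

/-- The affine piece belonging to `[t_{j-1}, t_j]`, `j ≥ 1`. -/
def eulerPiece (a b : ℝ) (n : ℕ) {d : ℕ} (η' : Vec d) (f' : ℝ → Vec d → Vec d) (τ : ℕ → ℝ)
    (j : ℕ) (t : ℝ) : Vec d :=
  ((t - node a b n (j - 1)) / step a b n) •
      (eulerSeq a b n η' f' τ j - eulerSeq a b n η' f' τ (j - 1)) +
    eulerSeq a b n η' f' τ (j - 1)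

/-- The piecewise linear approximation on `[a,b]`: the piece with index
`j = min (⌊(t - a) / h⌋ + 1) n`, for which `t ∈ [t_{j-1}, t_j]`. -/
def eulerApprox (a b : ℝ) (n : ℕ) {d : ℕ} (η' : Vec d) (f' : ℝ → Vec d → Vec d) (τ : ℕ → ℝ)
    (t : ℝ) : Vec d :=
  eulerPiece a b n η' f' τ (min (⌊(t - a) / step a b n⌋₊ + 1) n) t

/-- `sup_{a ≤ t ≤ b} ‖z(t) - l(t)‖`, as an extended nonnegative number. -/
def supError (a b : ℝ) {d : ℕ} (z l : ℝ → Vec d) : ℝ≥0∞ :=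
  ⨆ t ∈ Icc a b, ‖z t - l t‖ₑ

def radius₁ (a b K : ℝ) : ℝ := (K + 2) * Real.exp ((K + 1) * (b - a)) + K - 1

def radius₂ (a b K : ℝ) : ℝ := K * (1 + b - a) * Real.exp (K * (b - a)) + K

def radius₀ (a b K : ℝ) : ℝ := max (radius₁ a b K) (radius₂ a b K)

end RandEuler

end

/-! On each grid interval, freeze the state at the exact value `z (t_j)`. The increment of `z`
differs from the integral of the frozen field by O(h²), because `f` is Lipschitz in space near the
solution and `z` is Lipschitz in time. The Euler step replaces this integral by a one-point rule at
a uniform point, with a centred error of size at most h·L·h^ϱ. The frozen state is deterministic, so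
these quadrature errors are independent, whatever the noise does to the scheme; their partial sums
are of order h·h^ϱ·√n, that is h^(ϱ+1/2), in L^p.

Pathwise, a discrete Gronwall argument applied to the error minus the accumulated quadrature error
gives the bound at the grid points (`IVPClass.norm_node_error_le`). The noise costs O(δ) because the
scheme stays in a fixed ball (`IVPClass.norm_eulerSeq_le`), and interpolation adds O(h).

The maximum over partial sums needs no martingale inequality: coordinatewise it is at most the sum
of two walks reflected at zero, read at the final time. The mean of cosh of the suitably scaled
reflected walk grows by a factor of at most 1 + 1/n per step, which bounds all its moments
(`eLpNorm_reflectedWalk_le`). -/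

namespace RandEuler

/-! ### Reflected random walks and their moments -/

/-- The random walk with increments `x 1, x 2, …`, reflected at zero. -/
noncomputable def reflectedWalk (x : ℕ → ℝ) : ℕ → ℝ
  | 0 => 0
  | k + 1 => max 0 (reflectedWalk x k + x (k + 1))

lemma reflectedWalk_nonneg (x : ℕ → ℝ) (k : ℕ) : 0 ≤ reflectedWalk x k := by
  cases k with
  | zero => exact le_rfl
  | succ k => exact le_max_left _ _

/-- Reflection only pushes the walk up, and the walk is nonnegative at time `k`, so from there on it
dominates the free walk started at zero. -/
lemma sum_Ioc_le_reflectedWalk (x : ℕ → ℝ) {k n : ℕ} (h : k ≤ n) :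
    ∑ j ∈ Finset.Ioc k n, x j ≤ reflectedWalk x n := by
  induction n, h using Nat.le_induction with
  | base => simpa using reflectedWalk_nonneg x k
  | succ n hn ih =>
    rw [Finset.sum_Ioc_succ_top (by omega)]
    exact (by linarith : _ ≤ reflectedWalk x n + x (n + 1)).trans (le_max_right _ _)

/-- A partial sum is the full sum minus a tail, and each of these is dominated, with either sign, by
a reflected walk at time `n`. The right side does not depend on `k`, so it bounds the maximum. -/
lemma abs_sum_Ioc_le_reflectedWalk (x : ℕ → ℝ) {k n : ℕ} (h : k ≤ n) :
    |∑ j ∈ Finset.Ioc 0 k, x j| ≤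
      reflectedWalk x n + reflectedWalk (fun j => -x j) n := by
  have h1 := sum_Ioc_le_reflectedWalk x (Nat.zero_le n)
  have h2 := sum_Ioc_le_reflectedWalk (fun j => -x j) (Nat.zero_le n)
  have h3 := sum_Ioc_le_reflectedWalk x h
  have h4 := sum_Ioc_le_reflectedWalk (fun j => -x j) h
  have h5 := Finset.sum_Ioc_consecutive x (Nat.zero_le k) h
  simp only [Finset.sum_neg_distrib] at h2 h4
  rw [abs_le]
  constructor <;> linarith

lemma reflectedWalk_congr {x y : ℕ → ℝ} {k : ℕ} (h : ∀ j ∈ Finset.Icc 1 k, x j = y j) :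
    reflectedWalk x k = reflectedWalk y k := by
  induction k with
  | zero => rfl
  | succ k ih =>
    have h1 := ih fun j hj => h j (Finset.Icc_subset_Icc_right (by omega) hj)
    simp only [reflectedWalk, h1, h (k + 1) (by simp)]

lemma reflectedWalk_le {x : ℕ → ℝ} {c : ℝ} (hc : 0 ≤ c) {k : ℕ}
    (h : ∀ j ∈ Finset.Icc 1 k, x j ≤ c) : reflectedWalk x k ≤ k * c := by
  induction k with
  | zero => simp [reflectedWalk]
  | succ k ih =>
    have h1 := ih fun j hj => h j (Finset.Icc_subset_Icc_right (by omega) hj)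
    have h2 := h (k + 1) (by simp)
    push_cast
    exact max_le (by positivity) (by linarith)

lemma measurable_reflectedWalk {α : Type*} [MeasurableSpace α] {X : ℕ → α → ℝ} {k : ℕ}
    (h : ∀ j ∈ Finset.Icc 1 k, Measurable (X j)) :
    Measurable fun ω => reflectedWalk (fun j => X j ω) k := by
  induction k with
  | zero => exact measurable_const
  | succ k ih =>
    have h1 := ih fun j hj => h j (Finset.Icc_subset_Icc_right (by omega) hj)
    exact measurable_const.max (h1.add (h (k + 1) (by simp)))

/-- Apply exp y ≤ 1 + y + y² to y = x and y = -x. The term linear in `x` is kept apart because it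
averages to zero when `x` is centred and independent of `r`. -/
lemma cosh_add_le (r : ℝ) {x : ℝ} (hx : |x| ≤ 1) :
    Real.cosh (r + x) ≤ Real.cosh r * (1 + x ^ 2) + x * Real.sinh r := by
  have h1 := (abs_le.1 (Real.abs_exp_sub_one_sub_id_le hx)).2
  have h2 := (abs_le.1 (Real.abs_exp_sub_one_sub_id_le (x := -x) (by simpa using hx))).2
  have h3 : Real.exp r * Real.exp x ≤ Real.exp r * (1 + x + x ^ 2) :=
    mul_le_mul_of_nonneg_left (by linarith) (Real.exp_pos _).le
  have h4 : Real.exp (-r) * Real.exp (-x) ≤ Real.exp (-r) * (1 - x + x ^ 2) :=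
    mul_le_mul_of_nonneg_left (by linarith) (Real.exp_pos _).le
  rw [Real.cosh_eq, Real.cosh_eq, Real.sinh_eq, neg_add, Real.exp_add, Real.exp_add]
  linarith

lemma cosh_max_zero_le (s : ℝ) : Real.cosh (max 0 s) ≤ Real.cosh s := by
  rw [Real.cosh_le_cosh]
  rcases le_total 0 s with h | h
  · simp [h]
  · simp [h]

section

variable {Ω : Type*} [MeasurableSpace Ω] {P : Measure Ω}

/-- The walk at time `k` is a measurable function of the increments with indices up to `k`, a block
disjoint from `k + 1`. -/
lemma indepFun_reflectedWalk {n : ℕ} {X : ℕ → Ω → ℝ}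
    (hm : ∀ j ∈ Finset.Icc 1 n, Measurable (X j))
    (hX : iIndepFun (fun j : Finset.Icc 1 n => X j) P) {k : ℕ} (hk : k + 1 ≤ n) :
    IndepFun (fun ω => reflectedWalk (fun j => X j ω) k) (X (k + 1)) P := by
  classical
  set S : Finset (Finset.Icc 1 n) := Finset.univ.filter fun j => j.1 ≤ k
  set i₀ : Finset.Icc 1 n := ⟨k + 1, by simp; omega⟩
  have hST : Disjoint S {i₀} := by
    simp [S, i₀]
  have h1 := hX.indepFun_finset S {i₀} hST fun j => hm j j.2
  have hmem : ∀ j (h : j ∈ Finset.Icc 1 k),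
      (⟨j, Finset.Icc_subset_Icc_right (by omega) h⟩ : Finset.Icc 1 n) ∈ S := by
    intro j h
    simpa [S] using (Finset.mem_Icc.1 h).2
  -- The default value 0 is never read: the walk at time `k` sees only the indices 1 to `k`.
  let Φ : (S → ℝ) → ℝ := fun u => reflectedWalk
    (fun j => if h : j ∈ Finset.Icc 1 k then
      u ⟨⟨j, Finset.Icc_subset_Icc_right (by omega) h⟩, hmem j h⟩ else 0) k
  have hΦ : Measurable Φ := by
    refine measurable_reflectedWalk (X := fun j (u : S → ℝ) => if h : j ∈ Finset.Icc 1 k then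
      u ⟨⟨j, Finset.Icc_subset_Icc_right (by omega) h⟩, hmem j h⟩ else 0) fun j hj => ?_
    simp only [hj, dite_true]
    exact measurable_pi_apply _
  have h2 := h1.comp hΦ (measurable_pi_apply (⟨i₀, by simp⟩ : ({i₀} : Finset (Finset.Icc 1 n))))
  convert h2 using 1
  · funext ω
    refine reflectedWalk_congr fun j hj => ?_
    simp [hj, -Finset.mem_Icc]
  · rfl

lemma integrable_of_abs_le [IsFiniteMeasure P] {g : Ω → ℝ} (hg : Measurable g) {c : ℝ}
    (h : ∀ ω, |g ω| ≤ c) : Integrable g P :=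
  Integrable.of_bound hg.aestronglyMeasurable c (Filter.Eventually.of_forall h)

variable [IsProbabilityMeasure P]

/-- One step multiplies the mean by at most 1 + (lc)²: reflection does not increase cosh, and the
sinh term vanishes by independence and centring. -/
lemma integral_cosh_reflectedWalk_le {n : ℕ} {X : ℕ → Ω → ℝ} {c l : ℝ} (hl : 0 ≤ l)
    (hlc : l * c ≤ 1)
    (hm : ∀ j ∈ Finset.Icc 1 n, Measurable (X j))
    (hb : ∀ j ∈ Finset.Icc 1 n, ∀ ω, |X j ω| ≤ c)
    (h0 : ∀ j ∈ Finset.Icc 1 n, ∫ ω, X j ω ∂P = 0)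
    (hX : iIndepFun (fun j : Finset.Icc 1 n => X j) P) {k : ℕ} (hk : k ≤ n) :
    Integrable (fun ω => Real.cosh (l * reflectedWalk (fun j => X j ω) k)) P ∧
    ∫ ω, Real.cosh (l * reflectedWalk (fun j => X j ω) k) ∂P ≤ (1 + (l * c) ^ 2) ^ k := by
  have hsub : ∀ {k}, k ≤ n → ∀ j ∈ Finset.Icc 1 k, j ∈ Finset.Icc 1 n := fun hk j hj =>
    Finset.Icc_subset_Icc_right hk hj
  have hRm : ∀ k ≤ n, Measurable fun ω => reflectedWalk (fun j => X j ω) k := fun k hk =>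
    measurable_reflectedWalk fun j hj => hm j (hsub hk j hj)
  -- The sign of `c` follows from the bound on an increment, so at least one index and one point of
  -- `Ω` are needed.
  have hc : ∀ k, k + 1 ≤ n → 0 ≤ c := by
    intro k hk
    obtain ⟨ω⟩ := P.nonempty_of_neZero
    exact (abs_nonneg _).trans (hb (k + 1) (by simp; omega) ω)
  have hRb : ∀ k ≤ n, ∀ ω, |l * reflectedWalk (fun j => X j ω) k| ≤ l * (k * c) := by
    intro k hk ω
    rw [abs_mul, abs_of_nonneg hl, abs_of_nonneg (reflectedWalk_nonneg _ _)]
    refine mul_le_mul_of_nonneg_left ?_ hl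
    cases k with
    | zero => simp [reflectedWalk]
    | succ k =>
      exact reflectedWalk_le (hc k hk) fun j hj => (abs_le.1 (hb j (hsub hk j hj) ω)).2
  have hint : ∀ k ≤ n,
      Integrable (fun ω => Real.cosh (l * reflectedWalk (fun j => X j ω) k)) P := by
    intro k hk
    refine integrable_of_abs_le (Real.measurable_cosh.comp ((hRm k hk).const_mul l))
      (c := Real.cosh (l * (k * c))) fun ω => ?_
    rw [abs_of_pos (Real.cosh_pos _), Real.cosh_le_cosh]
    exact (hRb k hk ω).trans (le_abs_self _)
  refine ⟨hint k hk, ?_⟩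
  induction k with
  | zero => simp [reflectedWalk]
  | succ k ih =>
    have hk' : k ≤ n := by omega
    have hmem : k + 1 ∈ Finset.Icc 1 n := by simp; omega
    have ih := ih hk'
    have hsinh : Integrable (fun ω => Real.sinh (l * reflectedWalk (fun j => X j ω) k)) P := by
      refine (hint k hk').mono
        (Real.measurable_sinh.comp ((hRm k hk').const_mul l)).aestronglyMeasurable
        (Filter.Eventually.of_forall fun ω => ?_)
      rw [Real.norm_eq_abs, Real.norm_eq_abs, abs_of_pos (Real.cosh_pos _), ← Real.cosh_abs, Real.abs_sinh]
      exact (Real.sinh_lt_cosh _).le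
    have hXi : Integrable (X (k + 1)) P := integrable_of_abs_le (hm _ hmem) (hb _ hmem)
    have hind : IndepFun (X (k + 1))
        (fun ω => Real.sinh (l * reflectedWalk (fun j => X j ω) k)) P :=
      ((indepFun_reflectedWalk hm hX hk).comp
        (φ := fun r => Real.sinh (l * r)) (by fun_prop) measurable_id).symm
    have hprod : ∫ ω, X (k + 1) ω * Real.sinh (l * reflectedWalk (fun j => X j ω) k) ∂P = 0 := by
      have := hind.integral_mul_eq_mul_integral hXi.aestronglyMeasurable hsinh.aestronglyMeasurable
      simpa [h0 _ hmem] using this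
    have hprodi : Integrable
        (fun ω => X (k + 1) ω * Real.sinh (l * reflectedWalk (fun j => X j ω) k)) P :=
      hind.integrable_mul hXi hsinh
    have hpt : ∀ ω, Real.cosh (l * reflectedWalk (fun j => X j ω) (k + 1)) ≤
        (1 + (l * c) ^ 2) * Real.cosh (l * reflectedWalk (fun j => X j ω) k) +
        l * (X (k + 1) ω * Real.sinh (l * reflectedWalk (fun j => X j ω) k)) := by
      intro ω
      have hlX : |l * X (k + 1) ω| ≤ l * c := by
        rw [abs_mul, abs_of_nonneg hl]
        exact mul_le_mul_of_nonneg_left (hb _ hmem ω) hl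
      have h1 := cosh_add_le (l * reflectedWalk (fun j => X j ω) k) (hlX.trans hlc)
      have h2 : (l * X (k + 1) ω) ^ 2 ≤ (l * c) ^ 2 := sq_le_sq' (abs_le.1 hlX).1 (abs_le.1 hlX).2
      have h3 : Real.cosh (l * reflectedWalk (fun j => X j ω) (k + 1)) ≤
          Real.cosh (l * reflectedWalk (fun j => X j ω) k + l * X (k + 1) ω) := by
        rw [reflectedWalk, mul_max_of_nonneg _ _ hl, mul_zero, mul_add]
        exact cosh_max_zero_le _
      have h4 := mul_le_mul_of_nonneg_left h2
        (Real.cosh_pos (l * reflectedWalk (fun j => X j ω) k)).le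
      linarith
    calc ∫ ω, Real.cosh (l * reflectedWalk (fun j => X j ω) (k + 1)) ∂P
        ≤ ∫ ω, ((1 + (l * c) ^ 2) * Real.cosh (l * reflectedWalk (fun j => X j ω) k) +
          l * (X (k + 1) ω * Real.sinh (l * reflectedWalk (fun j => X j ω) k))) ∂P :=
          integral_mono (hint _ hk)
            (((hint k hk').const_mul _).add (hprodi.const_mul _)) hpt
      _ = (1 + (l * c) ^ 2) * ∫ ω, Real.cosh (l * reflectedWalk (fun j => X j ω) k) ∂P := by
          rw [integral_add ((hint k hk').const_mul _) (hprodi.const_mul _),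
            integral_const_mul, integral_const_mul, hprod, mul_zero, add_zero]
      _ ≤ (1 + (l * c) ^ 2) ^ (k + 1) := by
          rw [pow_succ' (1 + (l * c) ^ 2) k]
          exact mul_le_mul_of_nonneg_left ih (by positivity)

/-- The constant of the moment bound for reflected walks. -/
noncomputable def walkConst (p : ℝ) : ℝ :=
  (2 * (1 + (⌈p⌉₊.factorial : ℝ)) * Real.exp 1) ^ (1 / p)

lemma rpow_le_mul_cosh {p x : ℝ} (hp : 0 ≤ p) (hx : 0 ≤ x) :
    x ^ p ≤ 2 * (1 + (⌈p⌉₊.factorial : ℝ)) * Real.cosh x := by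
  have h1 : x ^ p ≤ 1 + x ^ ⌈p⌉₊ := by
    rcases le_total x 1 with h | h
    · exact (Real.rpow_le_one hx h hp).trans (by linarith [pow_nonneg hx ⌈p⌉₊])
    · rw [← Real.rpow_natCast]
      linarith [Real.rpow_le_rpow_of_exponent_le h (Nat.le_ceil p)]
  have h2 := Real.pow_div_factorial_le_exp x hx ⌈p⌉₊
  rw [div_le_iff₀ (by positivity)] at h2
  have h3 : Real.exp x ≤ 2 * Real.cosh x := by
    rw [Real.cosh_eq]; linarith [Real.exp_pos (-x)]
  have h4 := Real.one_le_exp hx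
  calc x ^ p ≤ (1 + (⌈p⌉₊.factorial : ℝ)) * Real.exp x := by linarith
    _ ≤ (1 + (⌈p⌉₊.factorial : ℝ)) * (2 * Real.cosh x) := by gcongr
    _ = _ := by ring

lemma eLpNorm_reflectedWalk_le {p : ℝ} (hp : 0 < p) {n : ℕ} (hn : 0 < n) {X : ℕ → Ω → ℝ} {c : ℝ}
    (hc : 0 < c)
    (hm : ∀ j ∈ Finset.Icc 1 n, Measurable (X j))
    (hb : ∀ j ∈ Finset.Icc 1 n, ∀ ω, |X j ω| ≤ c)
    (h0 : ∀ j ∈ Finset.Icc 1 n, ∫ ω, X j ω ∂P = 0)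
    (hX : iIndepFun (fun j : Finset.Icc 1 n => X j) P) :
    eLpNorm (fun ω => reflectedWalk (fun j => X j ω) n) (ENNReal.ofReal p) P ≤
      ENNReal.ofReal (walkConst p * (c * √n)) := by
  have hn' : (1 : ℝ) ≤ √n := by
    rw [Real.one_le_sqrt]; exact_mod_cast hn
  -- With this scale lc = 1/√n, so the cosh bound becomes (1 + 1/n)^n ≤ e, uniformly in `n`.
  set l : ℝ := (c * √n)⁻¹ with hl
  have hl0 : 0 < l := by positivity
  have hlc : l * c = (√n)⁻¹ := by rw [hl]; field_simp
  obtain ⟨hi, hle⟩ := integral_cosh_reflectedWalk_le hl0.le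
    (by rw [hlc]; exact inv_le_one_of_one_le₀ hn') hm hb h0 hX le_rfl
  have hle' : ∫ ω, Real.cosh (l * reflectedWalk (fun j => X j ω) n) ∂P ≤ Real.exp 1 := by
    refine hle.trans ?_
    rw [hlc, inv_pow, Real.sq_sqrt (by positivity), add_comm]
    calc ((n : ℝ)⁻¹ + 1) ^ n ≤ (Real.exp (n : ℝ)⁻¹) ^ n :=
          pow_le_pow_left₀ (by positivity) (Real.add_one_le_exp _) n
      _ = Real.exp 1 := by
          rw [← Real.exp_nat_mul, mul_inv_cancel₀ (by positivity)]
  set D : ℝ := 2 * (1 + (⌈p⌉₊.factorial : ℝ)) with hD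
  have hD0 : 0 < D := by positivity
  have hpt : ∀ ω, reflectedWalk (fun j => X j ω) n ^ p ≤
      (c * √n) ^ p * (D * Real.cosh (l * reflectedWalk (fun j => X j ω) n)) := by
    intro ω
    have hR := reflectedWalk_nonneg (fun j => X j ω) n
    have h1 := rpow_le_mul_cosh hp.le (mul_nonneg hl0.le hR)
    have h2 : reflectedWalk (fun j => X j ω) n =
        (c * √n) * (l * reflectedWalk (fun j => X j ω) n) := by
      rw [hl]; field_simp
    conv_lhs => rw [h2, Real.mul_rpow (by positivity) (mul_nonneg hl0.le hR)]
    gcongr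
  rw [eLpNorm_eq_lintegral_rpow_enorm_toReal (by simpa using hp) ENNReal.ofReal_ne_top,
    ENNReal.toReal_ofReal hp.le]
  have hkey : ∫⁻ ω, ‖reflectedWalk (fun j => X j ω) n‖ₑ ^ p ∂P ≤
      ENNReal.ofReal ((c * √n) ^ p * (D * Real.exp 1)) := by
    calc ∫⁻ ω, ‖reflectedWalk (fun j => X j ω) n‖ₑ ^ p ∂P
        ≤ ∫⁻ ω, ENNReal.ofReal
          ((c * √n) ^ p * (D * Real.cosh (l * reflectedWalk (fun j => X j ω) n))) ∂P := by
          refine lintegral_mono fun ω => ?_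
          have hR := reflectedWalk_nonneg (fun j => X j ω) n
          simp only
          rw [Real.enorm_of_nonneg hR, ENNReal.ofReal_rpow_of_nonneg hR hp.le]
          exact ENNReal.ofReal_le_ofReal (hpt ω)
      _ = ENNReal.ofReal (∫ ω,
          (c * √n) ^ p * (D * Real.cosh (l * reflectedWalk (fun j => X j ω) n)) ∂P) := by
          rw [ofReal_integral_eq_lintegral_ofReal ((hi.const_mul D).const_mul _)]
          refine Filter.Eventually.of_forall fun ω => ?_
          have := Real.cosh_pos (l * reflectedWalk (fun j => X j ω) n)
          simp only [Pi.zero_apply]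
          positivity
      _ ≤ _ := by
          rw [integral_const_mul, integral_const_mul]
          apply ENNReal.ofReal_le_ofReal
          gcongr
  calc (∫⁻ ω, ‖reflectedWalk (fun j => X j ω) n‖ₑ ^ p ∂P) ^ (1 / p)
      ≤ (ENNReal.ofReal ((c * √n) ^ p * (D * Real.exp 1))) ^ (1 / p) := by gcongr
    _ = ENNReal.ofReal (walkConst p * (c * √n)) := by
        rw [ENNReal.ofReal_rpow_of_nonneg (by positivity) (by positivity),
          Real.mul_rpow (by positivity) (by positivity), ← Real.rpow_mul (by positivity),
          mul_one_div_cancel hp.ne', Real.rpow_one, walkConst, mul_comm]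

end

end RandEuler

/-! ### A priori bounds, existence and uniqueness of the solution -/

namespace RandEuler

section RadialRetraction

variable {E : Type*} [NormedAddCommGroup E] [NormedSpace ℝ E]

/-- The radial retraction onto the closed ball of radius `ρ` around zero. -/
noncomputable def radialRetraction (ρ : ℝ) (x : E) : E := (ρ / max ρ ‖x‖) • x

variable {ρ : ℝ}

lemma radialRetraction_of_norm_le (hρ : 0 < ρ) {x : E} (hx : ‖x‖ ≤ ρ) :
    radialRetraction ρ x = x := by
  rw [radialRetraction, max_eq_left hx, div_self hρ.ne', one_smul]

lemma norm_radialRetraction_le_norm (hρ : 0 < ρ) (x : E) : ‖radialRetraction ρ x‖ ≤ ‖x‖ := by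
  have hm : 0 < max ρ ‖x‖ := lt_max_of_lt_left hρ
  rw [radialRetraction, norm_smul, Real.norm_of_nonneg (by positivity)]
  exact mul_le_of_le_one_left (norm_nonneg x) ((div_le_one hm).2 (le_max_left _ _))

lemma norm_radialRetraction_le (hρ : 0 < ρ) (x : E) : ‖radialRetraction ρ x‖ ≤ ρ := by
  have hm : 0 < max ρ ‖x‖ := lt_max_of_lt_left hρ
  rw [radialRetraction, norm_smul, Real.norm_of_nonneg (by positivity), div_mul_eq_mul_div,
    div_le_iff₀ hm]
  exact mul_le_mul_of_nonneg_left (le_max_right _ _) hρ.le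

/-- Changing the point and changing the scaling factor each cost at most ‖x - y‖. The argument works
in any normed space, so it covers the one norm. -/
lemma norm_radialRetraction_sub_le (hρ : 0 < ρ) (x y : E) :
    ‖radialRetraction ρ x - radialRetraction ρ y‖ ≤ 2 * ‖x - y‖ := by
  have hx : 0 < max ρ ‖x‖ := lt_max_of_lt_left hρ
  have hy : 0 < max ρ ‖y‖ := lt_max_of_lt_left hρ
  have h1 : radialRetraction ρ x - radialRetraction ρ y =
      (ρ / max ρ ‖x‖) • (x - y) + (ρ / max ρ ‖x‖ - ρ / max ρ ‖y‖) • y := by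
    simp only [radialRetraction]; module
  have h2 : ‖(ρ / max ρ ‖x‖) • (x - y)‖ ≤ ‖x - y‖ := by
    rw [norm_smul, Real.norm_of_nonneg (by positivity)]
    exact mul_le_of_le_one_left (norm_nonneg _) ((div_le_one hx).2 (le_max_left _ _))
  have h3 : ‖(ρ / max ρ ‖x‖ - ρ / max ρ ‖y‖) • y‖ ≤ ‖x - y‖ := by
    have h4 : ρ / max ρ ‖x‖ - ρ / max ρ ‖y‖ =
        (ρ / max ρ ‖x‖) * ((max ρ ‖y‖ - max ρ ‖x‖) / max ρ ‖y‖) := by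
      field_simp
    have h5 : |max ρ ‖y‖ - max ρ ‖x‖| ≤ ‖x - y‖ := by
      refine (abs_max_sub_max_le_max _ _ _ _).trans ?_
      rw [sub_self, abs_zero, max_eq_right (abs_nonneg _), norm_sub_rev]
      exact abs_norm_sub_norm_le y x
    rw [norm_smul, Real.norm_eq_abs, h4, abs_mul,
      abs_of_nonneg (by positivity : 0 ≤ ρ / max ρ ‖x‖), abs_div, abs_of_pos hy]
    have h6 : ρ / max ρ ‖x‖ ≤ 1 := (div_le_one hx).2 (le_max_left _ _)
    have h7 : ‖y‖ / max ρ ‖y‖ ≤ 1 := (div_le_one hy).2 (le_max_right _ _)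
    calc ρ / max ρ ‖x‖ * (|max ρ ‖y‖ - max ρ ‖x‖| / max ρ ‖y‖) * ‖y‖
        = ρ / max ρ ‖x‖ * (|max ρ ‖y‖ - max ρ ‖x‖| * (‖y‖ / max ρ ‖y‖)) := by ring
      _ ≤ 1 * (‖x - y‖ * 1) := by gcongr
      _ = ‖x - y‖ := by ring
  rw [h1]
  linarith [norm_add_le ((ρ / max ρ ‖x‖) • (x - y)) ((ρ / max ρ ‖x‖ - ρ / max ρ ‖y‖) • y)]

end RadialRetraction

/-- A priori bound for solutions over a time interval of length `T`. -/
noncomputable def solBound (K T : ℝ) : ℝ := (K + 1) * Real.exp (K * T) - 1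

lemma solBound_pos {K T : ℝ} (hK : 0 < K) (hT : 0 ≤ T) : 0 < solBound K T := by
  have : 1 ≤ Real.exp (K * T) := Real.one_le_exp (by positivity)
  rw [solBound]; nlinarith

lemma solBound_add_le_radius₀ {a b K : ℝ} (hK : 0 < K) (hab : a < b) :
    solBound K (b - a) + K ≤ radius₀ a b K := by
  refine le_trans ?_ (le_max_left _ _)
  have hT : 0 < b - a := sub_pos.2 hab
  have h : Real.exp (K * (b - a)) ≤ Real.exp ((K + 1) * (b - a)) := by
    apply Real.exp_le_exp.2; nlinarith
  rw [solBound, radius₁]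
  nlinarith [Real.exp_pos (K * (b - a))]

section

variable {E : Type*} [NormedAddCommGroup E] [NormedSpace ℝ E]

lemma hasDerivWithinAt_Ici_of_Icc {g : ℝ → E} {v : E} {a b t : ℝ} (ht : t ∈ Ico a b)
    (h : HasDerivWithinAt g v (Icc a b) t) : HasDerivWithinAt g v (Ici t) t :=
  (h.mono_of_mem_nhdsWithin (Icc_mem_nhdsGE_of_mem ht))

lemma norm_le_solBound {a b K : ℝ} (hK : 0 < K) {g g' : ℝ → E} (h0 : ‖g a‖ ≤ K)
    (hg : ∀ t ∈ Icc a b, HasDerivWithinAt g (g' t) (Icc a b) t)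
    (hg' : ∀ t ∈ Icc a b, ‖g' t‖ ≤ K * (1 + ‖g t‖)) :
    ∀ t ∈ Icc a b, ‖g t‖ ≤ solBound K (b - a) := by
  intro t ht
  have h := norm_le_gronwallBound_of_norm_deriv_right_le (K := K) (ε := K)
    (fun s hs => (hg s hs).continuousWithinAt)
    (fun s hs => hasDerivWithinAt_Ici_of_Icc hs (hg s (Ico_subset_Icc_self hs))) h0
    (fun s hs => (hg' s (Ico_subset_Icc_self hs)).trans (by linarith)) t ht
  refine h.trans ?_
  have hexp : Real.exp (K * (t - a)) ≤ Real.exp (K * (b - a)) := by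
    apply Real.exp_le_exp.2
    gcongr
    exact ht.2
  rw [gronwallBound_of_K_ne_0 hK.ne', div_self hK.ne', solBound]
  nlinarith

end

variable {a b ϱ K L R : ℝ} {d : ℕ} {η : Vec d} {f : ℝ → Vec d → Vec d}

lemma IVPClass.mem_closedBall (H : IVPClass a b ϱ K L R η f) (hR : solBound K (b - a) + K ≤ R)
    {x : Vec d} (hx : ‖x‖ ≤ solBound K (b - a)) : x ∈ Metric.closedBall η R := by
  rw [mem_closedBall_iff_norm]
  linarith [norm_sub_le x η, H.norm_init]

lemma IVPClass.norm_solution_le (H : IVPClass a b ϱ K L R η f) (hK : 0 < K) {z : ℝ → Vec d}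
    (hz : IsSolution a b η f z) : ∀ t ∈ Icc a b, ‖z t‖ ≤ solBound K (b - a) :=
  norm_le_solBound hK (by rw [hz.1]; exact H.norm_init) hz.2 fun t ht => H.growth t ht _

lemma IVPClass.solution_unique (H : IVPClass a b ϱ K L R η f) (hK : 0 < K) (hL : 0 ≤ L)
    (hR : solBound K (b - a) + K ≤ R) {z w : ℝ → Vec d}
    (hz : IsSolution a b η f z) (hw : IsSolution a b η f w) : EqOn w z (Icc a b) := by
  refine ODE_solution_unique_of_mem_Icc_right (v := f) (s := fun _ => Metric.closedBall η R)
    (K := L.toNNReal) (fun t ht => ?_)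
    (fun s hs => (hw.2 s hs).continuousWithinAt)
    (fun s hs => hasDerivWithinAt_Ici_of_Icc hs (hw.2 s (Ico_subset_Icc_self hs)))
    (fun s hs => H.mem_closedBall hR (H.norm_solution_le hK hw s (Ico_subset_Icc_self hs)))
    (fun s hs => (hz.2 s hs).continuousWithinAt)
    (fun s hs => hasDerivWithinAt_Ici_of_Icc hs (hz.2 s (Ico_subset_Icc_self hs)))
    (fun s hs => H.mem_closedBall hR (H.norm_solution_le hK hz s (Ico_subset_Icc_self hs)))
    (by rw [hz.1, hw.1])
  refine LipschitzOnWith.of_dist_le_mul fun x hx y hy => ?_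
  rw [dist_eq_norm, dist_eq_norm, Real.coe_toNNReal _ hL]
  exact H.lipschitz t (Ico_subset_Icc_self ht) x hx y hy

lemma IVPClass.continuousOn_left (H : IVPClass a b ϱ K L R η f) (x : Vec d) :
    ContinuousOn (fun t => f t x) (Icc a b) :=
  H.continuousOn.comp (f := fun t : ℝ => (t, x)) (by fun_prop) fun _ ht => ⟨ht, mem_univ _⟩

/-- Composing with the radial retraction makes the field bounded and globally Lipschitz without
spoiling its linear growth. Gronwall then keeps the solution where the retraction is the identity.
-/
lemma IVPClass.exists_solution (H : IVPClass a b ϱ K L R η f) (hab : a < b) (hK : 0 < K)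
    (hL : 0 ≤ L) (hR : solBound K (b - a) + K ≤ R) :
    ∃ z : ℝ → Vec d, IsSolution a b η f z := by
  set ρ := solBound K (b - a) with hρdef
  have hρ : 0 < ρ := solBound_pos hK (sub_pos.2 hab).le
  have hmem : ∀ x : Vec d, radialRetraction ρ x ∈ Metric.closedBall η R := fun x =>
    H.mem_closedBall hR (norm_radialRetraction_le hρ x)
  have hM : 0 ≤ K * (1 + ρ) := by positivity
  have hT : 0 < b - a := sub_pos.2 hab
  -- The radius is the field bound times the interval length, so the solution exists on all of [a,b]
  -- at once.
  have hPL : IsPicardLindelof (fun t x => f t (radialRetraction ρ x))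
      (⟨a, left_mem_Icc.2 hab.le⟩ : Icc a b) η (K * (1 + ρ) * (b - a)).toNNReal 0
      (K * (1 + ρ)).toNNReal (2 * L).toNNReal := by
    refine ⟨fun t ht => ?_, fun x _ => H.continuousOn_left _, fun t ht x _ => ?_, ?_⟩
    · refine LipschitzOnWith.of_dist_le_mul fun x _ y _ => ?_
      rw [dist_eq_norm, dist_eq_norm, Real.coe_toNNReal _ (by positivity)]
      refine (H.lipschitz t ht _ (hmem x) _ (hmem y)).trans ?_
      rw [mul_comm 2 L, mul_assoc]
      exact mul_le_mul_of_nonneg_left (norm_radialRetraction_sub_le hρ x y) hL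
    · rw [Real.coe_toNNReal _ hM]
      refine (H.growth t ht _).trans ?_
      gcongr
      exact norm_radialRetraction_le hρ x
    · rw [Real.coe_toNNReal _ hM, Real.coe_toNNReal _ (by positivity)]
      simp [hT.le]
  obtain ⟨z, hz0, hz⟩ := hPL.exists_eq_forall_mem_Icc_hasDerivWithinAt₀
  have hb : ∀ t ∈ Icc a b, ‖z t‖ ≤ ρ :=
    norm_le_solBound hK (by rw [show z a = η from hz0]; exact H.norm_init) hz fun t ht =>
      (H.growth t ht _).trans (by gcongr; exact norm_radialRetraction_le_norm hρ _)
  refine ⟨z, hz0, fun t ht => ?_⟩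
  have := hz t ht
  rwa [radialRetraction_of_norm_le hρ (hb t ht)] at this

lemma IVPClass.norm_solution_sub_le (H : IVPClass a b ϱ K L R η f) (hK : 0 < K) {z : ℝ → Vec d}
    (hz : IsSolution a b η f z) {s t : ℝ} (hs : s ∈ Icc a b) (ht : t ∈ Icc a b) :
    ‖z t - z s‖ ≤ K * (1 + solBound K (b - a)) * |t - s| :=
  (convex_Icc a b).norm_image_sub_le_of_norm_hasDerivWithin_le hz.2 (fun r hr =>
    (H.growth r hr _).trans (by gcongr; exact H.norm_solution_le hK hz r hr)) hs ht

end RandEuler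

/-! ### Grid, frozen field and local errors -/

namespace RandEuler

section Grid

variable {a b : ℝ} {n : ℕ}

lemma step_pos (hab : a < b) (hn : 0 < n) : 0 < step a b n :=
  div_pos (sub_pos.2 hab) (by exact_mod_cast hn)

lemma nat_mul_step (hn : 0 < n) : n * step a b n = b - a := by
  rw [step]; field_simp

lemma node_zero : node a b n 0 = a := by simp [node]

lemma node_succ (j : ℕ) : node a b n (j + 1) = node a b n j + step a b n := by
  simp only [node]; push_cast; ring

lemma node_self (hn : 0 < n) : node a b n n = b := by
  rw [node, nat_mul_step hn]; ring

lemma node_add_mul_mem (hab : a < b) {j : ℕ} (hj : j < n) {u : ℝ} (hu : u ∈ Icc (0 : ℝ) 1) :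
    node a b n j + u * step a b n ∈ Icc a b := by
  have hn : 0 < n := by omega
  have hh := step_pos hab hn
  have h1 : ((j : ℝ) + 1) * step a b n ≤ n * step a b n := by
    gcongr; exact_mod_cast hj
  rw [nat_mul_step hn] at h1
  have h2 : u * step a b n ≤ 1 * step a b n := by gcongr; exact hu.2
  have h3 : 0 ≤ u * step a b n := mul_nonneg hu.1 hh.le
  have h4 : (0 : ℝ) ≤ j * step a b n := by positivity
  constructor <;> simp only [node] <;> linarith

lemma node_mem (hab : a < b) (hn : 0 < n) {j : ℕ} (hj : j ≤ n) : node a b n j ∈ Icc a b := by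
  rcases hj.lt_or_eq with h | rfl
  · simpa using node_add_mul_mem hab h (left_mem_Icc.2 zero_le_one)
  · rw [node_self hn]; exact right_mem_Icc.2 hab.le

lemma mem_grid_interval (hab : a < b) (hn : 0 < n) {t : ℝ} (ht : t ∈ Icc a b) :
    ∃ j < n, min (⌊(t - a) / step a b n⌋₊ + 1) n = j + 1 ∧
      (t - node a b n j) / step a b n ∈ Icc (0 : ℝ) 1 := by
  have hh := step_pos hab hn
  have hx : 0 ≤ (t - a) / step a b n := div_nonneg (sub_nonneg.2 ht.1) hh.le
  have key : ∀ j : ℕ, (t - node a b n j) / step a b n = (t - a) / step a b n - j := by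
    intro j; rw [node]; field_simp; ring
  have hle : (t - a) / step a b n ≤ n := by
    rw [div_le_iff₀ hh, nat_mul_step hn]; linarith [ht.2]
  rcases lt_or_ge ⌊(t - a) / step a b n⌋₊ n with h | h
  · refine ⟨_, h, min_eq_left h, ?_⟩
    rw [key]
    have h1 := Nat.floor_le hx
    have h2 := Nat.lt_floor_add_one ((t - a) / step a b n)
    constructor <;> linarith
  -- Only t = b arises here; the cap assigns it to the right end of the last interval.
  · refine ⟨n - 1, by omega, by omega, ?_⟩
    rw [key, Nat.cast_sub hn]
    have h1 : (n : ℝ) ≤ (t - a) / step a b n := (Nat.le_floor_iff hx).1 h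
    push_cast
    constructor <;> linarith

end Grid

/-- The interval `[0,1]` clamp. -/
noncomputable def clamp (u : ℝ) : ℝ := max 0 (min 1 u)

lemma clamp_mem (u : ℝ) : clamp u ∈ Icc (0 : ℝ) 1 :=
  ⟨le_max_left _ _, max_le zero_le_one (min_le_left _ _)⟩

lemma clamp_of_mem {u : ℝ} (hu : u ∈ Icc (0 : ℝ) 1) : clamp u = u := by
  rw [clamp, min_eq_right hu.2, max_eq_right hu.1]

lemma continuous_clamp : Continuous clamp := by unfold clamp; fun_prop

/-- The right-hand side along `[t_j, t_{j+1}]`, with the state frozen at `z (t_j)`, in the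
rescaled time `u ∈ [0,1]`. -/
noncomputable def frozenField (a b : ℝ) (n : ℕ) {d : ℕ} (f : ℝ → Vec d → Vec d) (z : ℝ → Vec d)
    (j : ℕ) (u : ℝ) : Vec d :=
  f (node a b n j + clamp u * step a b n) (z (node a b n j))

/-- The quadrature error of the one-point rule with evaluation point `u` for `frozenField`. -/
noncomputable def quadError (a b : ℝ) (n : ℕ) {d : ℕ} (f : ℝ → Vec d → Vec d) (z : ℝ → Vec d)
    (j : ℕ) (u : ℝ) : Vec d :=
  (∫ v in (0 : ℝ)..1, frozenField a b n f z j v) - frozenField a b n f z j u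

variable {a b ϱ K L R : ℝ} {d : ℕ} {η : Vec d} {f : ℝ → Vec d → Vec d} {z : ℝ → Vec d} {n : ℕ}

/-- The clamp gives continuity on all of ℝ, so that the quadrature errors are measurable and bounded
for every ω, not just almost every one. -/
lemma IVPClass.continuous_frozenField (H : IVPClass a b ϱ K L R η f) (hab : a < b) {j : ℕ}
    (hj : j < n) : Continuous (frozenField a b n f z j) :=
  (H.continuousOn_left _).comp_continuous
    ((continuous_clamp.mul continuous_const).const_add (node a b n j))
    fun u => node_add_mul_mem hab hj (clamp_mem u)

lemma IVPClass.norm_quadError_le (H : IVPClass a b ϱ K L R η f) (hab : a < b) (hK : 0 < K)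
    (hL : 0 ≤ L) (hϱ : 0 ≤ ϱ) (hR : solBound K (b - a) + K ≤ R) (hz : IsSolution a b η f z) {j : ℕ}
    (hj : j < n) (u : ℝ) : ‖quadError a b n f z j u‖ ≤ L * step a b n ^ ϱ := by
  have hh := step_pos hab (by omega : 0 < n)
  have hc := H.continuous_frozenField (z := z) hab hj
  have hmem : z (node a b n j) ∈ Metric.closedBall η R :=
    H.mem_closedBall hR (H.norm_solution_le hK hz _ (node_mem hab (by omega) hj.le))
  have h1 : quadError a b n f z j u =
      ∫ v in (0 : ℝ)..1, (frozenField a b n f z j v - frozenField a b n f z j u) := by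
    rw [intervalIntegral.integral_sub (hc.intervalIntegrable _ _) intervalIntegrable_const,
      quadError]
    simp
  rw [h1]
  refine (intervalIntegral.norm_integral_le_of_norm_le_const fun v _ => ?_).trans
    (by rw [sub_zero, abs_one, mul_one])
  refine (H.holder _ (node_add_mul_mem hab hj (clamp_mem v)) _
    (node_add_mul_mem hab hj (clamp_mem u)) _ hmem).trans ?_
  have h2 : |clamp v - clamp u| ≤ 1 := by
    have hv := clamp_mem v
    have hu := clamp_mem u
    rw [abs_le]; constructor <;> linarith [hv.1, hv.2, hu.1, hu.2]
  have h3 : |node a b n j + clamp v * step a b n - (node a b n j + clamp u * step a b n)| ≤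
      step a b n := by
    rw [add_sub_add_left_eq_sub, ← sub_mul, abs_mul, abs_of_pos hh]
    exact mul_le_of_le_one_left hh.le h2
  gcongr

/-- In rescaled time the difference has derivative h·(f(·, z(t)) - f(·, z(t_j))), which is O(h²) by
the two Lipschitz bounds; the mean value inequality concludes. -/
lemma IVPClass.norm_local_error_le (H : IVPClass a b ϱ K L R η f) (hab : a < b) (hK : 0 < K)
    (hL : 0 ≤ L) (hR : solBound K (b - a) + K ≤ R) (hz : IsSolution a b η f z) {j : ℕ}
    (hj : j < n) :
    ‖z (node a b n (j + 1)) - z (node a b n j) -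
      step a b n • ∫ v in (0 : ℝ)..1, frozenField a b n f z j v‖ ≤
      step a b n * (L * (K * (1 + solBound K (b - a)) * step a b n)) := by
  have hh := step_pos hab (by omega : 0 < n)
  set h := step a b n with hhdef
  set x := node a b n j with hx
  have hc := H.continuous_frozenField (z := z) hab hj
  have hxm : x ∈ Icc a b := node_mem hab (by omega) hj.le
  have hmap : MapsTo (fun u : ℝ => x + u * h) (Icc 0 1) (Icc a b) := fun u hu =>
    node_add_mul_mem hab hj hu
  have hd : ∀ u ∈ Icc (0 : ℝ) 1, HasDerivWithinAt
      (fun u => z (x + u * h) - h • ∫ v in (0 : ℝ)..u, frozenField a b n f z j v)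
      (h • f (x + u * h) (z (x + u * h)) - h • frozenField a b n f z j u) (Icc 0 1) u := by
    intro u hu
    have h1 : HasDerivWithinAt (fun u : ℝ => x + u * h) h (Icc 0 1) u := by
      simpa using ((hasDerivAt_id u).mul_const h).const_add x |>.hasDerivWithinAt
    have h2 := HasDerivWithinAt.scomp u (hz.2 _ (hmap hu)) h1 hmap
    have h3 := (hc.integral_hasStrictDerivAt 0 u).hasDerivAt.hasDerivWithinAt (s := Icc 0 1)
    exact h2.sub (h3.const_smul h)
  have hbound : ∀ u ∈ Ico (0 : ℝ) 1,
      ‖h • f (x + u * h) (z (x + u * h)) - h • frozenField a b n f z j u‖ ≤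
      h * (L * (K * (1 + solBound K (b - a)) * h)) := by
    intro u hu
    have hu' := Ico_subset_Icc_self hu
    have hm := hmap hu'
    rw [← smul_sub, norm_smul, Real.norm_of_nonneg hh.le, frozenField, clamp_of_mem hu', ← hx,
      ← hhdef]
    refine mul_le_mul_of_nonneg_left ?_ hh.le
    refine (H.lipschitz _ hm _ (H.mem_closedBall hR (H.norm_solution_le hK hz _ hm)) _
      (H.mem_closedBall hR (H.norm_solution_le hK hz _ hxm))).trans ?_
    refine mul_le_mul_of_nonneg_left ?_ hL
    refine (H.norm_solution_sub_le hK hz hxm hm).trans ?_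
    have hs := solBound_pos hK (sub_pos.2 hab).le
    refine mul_le_mul_of_nonneg_left ?_ (by positivity)
    rw [add_sub_cancel_left, abs_of_nonneg (mul_nonneg hu.1 hh.le)]
    exact mul_le_of_le_one_left hh.le hu'.2
  have key := norm_image_sub_le_of_norm_deriv_le_segment' hd hbound 1 (right_mem_Icc.2 zero_le_one)
  have e1 : x + 1 * h = node a b n (j + 1) := by rw [node_succ, one_mul]
  have e2 : x + 0 * h = x := by ring
  rw [e1, e2, intervalIntegral.integral_same, smul_zero, sub_zero, sub_zero, mul_one] at key
  rwa [sub_right_comm] at key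

/-! ### Pathwise error of the scheme -/

section Scheme

/-- A bound for `1 + ‖V‖` along the perturbed scheme over a time interval of length `T`. -/
noncomputable def schemeBound (K T : ℝ) : ℝ := (K + 2) * Real.exp ((K + 1) * T)

lemma schemeBound_sub_le_radius₀ {a b K : ℝ} : schemeBound K (b - a) - 1 + K ≤ radius₀ a b K :=
  le_trans (by rw [schemeBound, radius₁]; linarith) (le_max_left _ _)

variable {δ : ℝ} {η' : Vec d} {f' e : ℝ → Vec d → Vec d} {τ : ℕ → ℝ}

lemma evalPoint_mem (hab : a < b) (hτ : ∀ j < n, τ (j + 1) ∈ Icc (0 : ℝ) 1) {j : ℕ} (hj : j < n) :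
    evalPoint a b n τ (j + 1) ∈ Icc a b :=
  node_add_mul_mem hab hj (hτ j hj)

lemma one_add_mul_pow_le_exp {c : ℝ} (hc : 0 ≤ c) (hab : a < b) {j : ℕ} (hn : 0 < n) (hj : j ≤ n) :
    (1 + c * step a b n) ^ j ≤ Real.exp (c * (b - a)) := by
  have hh := step_pos hab hn
  calc (1 + c * step a b n) ^ j ≤ (1 + c * step a b n) ^ n :=
        pow_le_pow_right₀ (by linarith [mul_nonneg hc hh.le]) hj
    _ ≤ (Real.exp (c * step a b n)) ^ n := by
        refine pow_le_pow_left₀ (by positivity) ?_ n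
        rw [add_comm]; exact Real.add_one_le_exp _
    _ = Real.exp (c * (b - a)) := by
        rw [← Real.exp_nat_mul, ← nat_mul_step (a := a) (b := b) hn]; congr 1; ring

/-- The perturbed field has linear growth with constant K + δ ≤ K + 1, so each step multiplies 1 +
‖V‖ by at most 1 + (K+1)h, from an initial value of at most K + 2. -/
lemma IVPClass.norm_eulerSeq_le (H : IVPClass a b ϱ K L R η f) (hab : a < b) (hK : 0 < K)
    (hδ : δ ∈ Icc (0 : ℝ) 1) (hη : η' ∈ Metric.closedBall η δ) (he : NoiseClass a b δ e)
    (hf : ∀ t ∈ Icc a b, ∀ y, f' t y = f t y + e t y)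
    (hτ : ∀ j < n, τ (j + 1) ∈ Icc (0 : ℝ) 1) (hn : 0 < n) {j : ℕ} (hj : j ≤ n) :
    1 + ‖eulerSeq a b n η' f' τ j‖ ≤ schemeBound K (b - a) := by
  have hh := step_pos hab hn
  have key : ∀ j ≤ n, 1 + ‖eulerSeq a b n η' f' τ j‖ ≤
      (K + 2) * (1 + (K + 1) * step a b n) ^ j := by
    intro j hj
    induction j with
    | zero =>
      rw [mem_closedBall_iff_norm] at hη
      have h1 := norm_add_le (η' - η) η
      rw [sub_add_cancel] at h1
      simp only [eulerSeq, pow_zero]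
      linarith [H.norm_init, hδ.2]
    | succ j ih =>
      have ih := ih (by omega)
      have hθ := evalPoint_mem hab hτ (by omega : j < n)
      set V := eulerSeq a b n η' f' τ j with hV
      have h1 : ‖f' (evalPoint a b n τ (j + 1)) V‖ ≤ (K + 1) * (1 + ‖V‖) := by
        rw [hf _ hθ]
        refine (norm_add_le _ _).trans ?_
        have h2 := H.growth _ hθ V
        have h3 := he.growth _ hθ V
        have h4 : δ * (1 + ‖V‖) ≤ 1 * (1 + ‖V‖) := by gcongr; exact hδ.2
        linarith
      have h2 : ‖eulerSeq a b n η' f' τ (j + 1)‖ ≤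
          ‖V‖ + step a b n * ((K + 1) * (1 + ‖V‖)) := by
        rw [eulerSeq]
        refine (norm_add_le _ _).trans ?_
        rw [norm_smul, Real.norm_of_nonneg hh.le]
        gcongr
      have h3 := mul_le_mul_of_nonneg_left ih (by positivity : 0 ≤ 1 + (K + 1) * step a b n)
      rw [pow_succ]
      linarith
  refine (key j hj).trans ?_
  rw [schemeBound]
  have := one_add_mul_pow_le_exp (c := K + 1) (by positivity) hab hn hj
  gcongr

/-- Bound for the error at the grid points in terms of the accumulated quadrature error. -/
lemma IVPClass.norm_node_error_le (H : IVPClass a b ϱ K L R η f) (hab : a < b) (hK : 0 < K)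
    (hL : 0 < L) (hR : solBound K (b - a) + K ≤ R) (hR' : schemeBound K (b - a) - 1 + K ≤ R)
    (hz : IsSolution a b η f z)
    (hδ : δ ∈ Icc (0 : ℝ) 1) (hη : η' ∈ Metric.closedBall η δ) (he : NoiseClass a b δ e)
    (hf : ∀ t ∈ Icc a b, ∀ y, f' t y = f t y + e t y)
    (hτ : ∀ j < n, τ (j + 1) ∈ Icc (0 : ℝ) 1) (hn : 0 < n) {N : ℝ}
    (hN : ∀ j ≤ n,
      ‖∑ i ∈ Finset.range j, step a b n • quadError a b n f z i (τ (i + 1))‖ ≤ N)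
    {j : ℕ} (hj : j ≤ n) :
    ‖z (node a b n j) - eulerSeq a b n η' f' τ j‖ ≤
      N + Real.exp (L * (b - a)) * (δ + (K * (1 + solBound K (b - a)) * step a b n + N +
        δ * schemeBound K (b - a) / L)) := by
  have hh := step_pos hab hn
  have hV := fun {j} => H.norm_eulerSeq_le (j := j) hab hK hδ hη he hf hτ hn
  set h := step a b n with hhdef
  set A := schemeBound K (b - a) with hA
  set M := K * (1 + solBound K (b - a)) with hM
  have hM0 : 0 ≤ M := by
    have := solBound_pos hK (sub_pos.2 hab).le
    positivity
  have hA0 : 0 ≤ A := by rw [hA, schemeBound]; positivity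
  have hN0 : 0 ≤ N := by simpa using hN 0 (Nat.zero_le n)
  set D := M * h + N + δ * A / L with hD
  have hLD : L * D = L * (M * h) + L * N + δ * A := by rw [hD]; field_simp
  have hδ0 := hδ.1
  have hD0 : 0 ≤ D := by positivity
  let u : ℕ → Vec d := fun j => z (node a b n j) - eulerSeq a b n η' f' τ j -
    ∑ i ∈ Finset.range j, h • quadError a b n f z i (τ (i + 1))
  have key : ∀ j ≤ n, ‖u j‖ + D ≤ (1 + L * h) ^ j * (δ + D) := by
    intro j hj
    induction j with
    | zero =>
      have : u 0 = η - η' := by simp [u, node_zero, eulerSeq, hz.1]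
      rw [mem_closedBall_iff_norm'] at hη
      rw [this, pow_zero, one_mul]
      linarith
    | succ j ih =>
      have hjn : j < n := by omega
      have ih := ih hjn.le
      have hθ := evalPoint_mem hab hτ hjn
      have hzj := H.mem_closedBall hR
        (H.norm_solution_le hK hz _ (node_mem hab hn hjn.le))
      have hVj : eulerSeq a b n η' f' τ j ∈ Metric.closedBall η R := by
        rw [mem_closedBall_iff_norm]
        linarith [norm_sub_le (eulerSeq a b n η' f' τ j) η, H.norm_init, hV hjn.le]
      have hfrozen : frozenField a b n f z j (τ (j + 1)) =
          f (evalPoint a b n τ (j + 1)) (z (node a b n j)) := by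
        rw [frozenField, clamp_of_mem (hτ j hjn)]; rfl
      -- Subtracting the quadrature errors leaves only the local error, a Lipschitz term and the
      -- noise. The random sum enters only through `N`, when `u` is compared with the true error.
      have hrec : u (j + 1) = u j +
          (z (node a b n (j + 1)) - z (node a b n j) -
            h • ∫ v in (0 : ℝ)..1, frozenField a b n f z j v) +
          h • (f (evalPoint a b n τ (j + 1)) (z (node a b n j)) -
            f (evalPoint a b n τ (j + 1)) (eulerSeq a b n η' f' τ j)) -
          h • e (evalPoint a b n τ (j + 1)) (eulerSeq a b n η' f' τ j) := by
        simp only [u, Finset.sum_range_succ, eulerSeq, quadError, hfrozen, hf _ hθ, ← hhdef]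
        module
      have b1 := H.norm_local_error_le hab hK hL.le hR hz hjn
      have b2 := H.lipschitz _ hθ _ hzj _ hVj
      have b3 := he.growth _ hθ (eulerSeq a b n η' f' τ j)
      have b4 : ‖z (node a b n j) - eulerSeq a b n η' f' τ j‖ ≤ ‖u j‖ + N := by
        have := norm_add_le (u j)
          (∑ i ∈ Finset.range j, h • quadError a b n f z i (τ (i + 1)))
        rw [sub_add_cancel] at this
        linarith [hN j hjn.le]
      have b5 : δ * (1 + ‖eulerSeq a b n η' f' τ j‖) ≤ δ * A :=
        mul_le_mul_of_nonneg_left (hV hjn.le) hδ0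
      have b6 := b2.trans (mul_le_mul_of_nonneg_left b4 hL.le)
      have hstep : ‖u (j + 1)‖ ≤ ‖u j‖ + h * (L * (M * h)) + h * (L * (‖u j‖ + N)) +
          h * (δ * A) := by
        rw [hrec]
        refine (norm_sub_le _ _).trans (add_le_add ((norm_add_le _ _).trans
          (add_le_add ((norm_add_le _ _).trans (add_le_add_right b1 _)) ?_)) ?_)
        · rw [norm_smul, Real.norm_of_nonneg hh.le]
          exact mul_le_mul_of_nonneg_left b6 hh.le
        · rw [norm_smul, Real.norm_of_nonneg hh.le]
          exact mul_le_mul_of_nonneg_left (b3.trans b5) hh.le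
      have h3 := mul_le_mul_of_nonneg_left ih (by positivity : 0 ≤ 1 + L * h)
      have h4 : h * (L * D) = h * (L * (M * h) + L * N + δ * A) := by rw [hLD]
      rw [pow_succ]
      linarith
  have h1 := key j hj
  have h2 := mul_le_mul_of_nonneg_right (one_add_mul_pow_le_exp (c := L) hL.le hab hn hj)
    (by positivity : 0 ≤ δ + D)
  have h3 := norm_add_le (u j)
    (∑ i ∈ Finset.range j, h • quadError a b n f z i (τ (i + 1)))
  rw [sub_add_cancel] at h3
  linarith [hN j hj]

/-- Passing from the error at the grid points to the error of the piecewise linear function. -/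
lemma IVPClass.norm_sub_eulerApprox_le (H : IVPClass a b ϱ K L R η f) (hab : a < b) (hK : 0 < K)
    (hz : IsSolution a b η f z) (hn : 0 < n) {E : ℝ}
    (hE : ∀ j ≤ n, ‖z (node a b n j) - eulerSeq a b n η' f' τ j‖ ≤ E)
    {t : ℝ} (ht : t ∈ Icc a b) :
    ‖z t - eulerApprox a b n η' f' τ t‖ ≤ 2 * (K * (1 + solBound K (b - a)) * step a b n) + E := by
  have hh := step_pos hab hn
  obtain ⟨j, hj, hmin, hs⟩ := mem_grid_interval hab hn ht
  rw [eulerApprox, hmin, eulerPiece, Nat.add_sub_cancel]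
  set s := (t - node a b n j) / step a b n with hsdef
  have hts : t - node a b n j = s * step a b n := by rw [hsdef]; field_simp
  have hM0 : 0 ≤ K * (1 + solBound K (b - a)) := by
    have := solBound_pos hK (sub_pos.2 hab).le
    positivity
  have hj0 := node_mem (a := a) (b := b) hab hn hj.le
  have hj1 := node_mem (a := a) (b := b) hab hn hj
  have b1 : ‖z t - z (node a b n j)‖ ≤ K * (1 + solBound K (b - a)) * step a b n := by
    refine (H.norm_solution_sub_le hK hz hj0 ht).trans (mul_le_mul_of_nonneg_left ?_ hM0)
    rw [hts, abs_of_nonneg (mul_nonneg hs.1 hh.le)]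
    exact mul_le_of_le_one_left hh.le hs.2
  have b2 : ‖z (node a b n (j + 1)) - z (node a b n j)‖ ≤
      K * (1 + solBound K (b - a)) * step a b n := by
    refine (H.norm_solution_sub_le hK hz hj0 hj1).trans (mul_le_mul_of_nonneg_left ?_ hM0)
    rw [node_succ, add_sub_cancel_left, abs_of_pos hh]
  -- The first part is the distance from `z` to its own chord; the second is a convex combination of
  -- two grid errors.
  have hsplit : z t - (s • (eulerSeq a b n η' f' τ (j + 1) - eulerSeq a b n η' f' τ j) +
      eulerSeq a b n η' f' τ j) =
      (z t - z (node a b n j)) - s • (z (node a b n (j + 1)) - z (node a b n j)) +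
      ((1 - s) • (z (node a b n j) - eulerSeq a b n η' f' τ j) +
        s • (z (node a b n (j + 1)) - eulerSeq a b n η' f' τ (j + 1))) := by
    module
  rw [hsplit]
  refine (norm_add_le _ _).trans (add_le_add ((norm_sub_le _ _).trans ?_)
    ((norm_add_le _ _).trans ?_))
  · rw [norm_smul, Real.norm_of_nonneg hs.1]
    have := mul_le_of_le_one_left (norm_nonneg (z (node a b n (j + 1)) - z (node a b n j))) hs.2
    linarith
  · rw [norm_smul, norm_smul, Real.norm_of_nonneg hs.1, Real.norm_of_nonneg (sub_nonneg.2 hs.2)]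
    have h1 := mul_le_mul_of_nonneg_left (hE j hj.le) (sub_nonneg.2 hs.2)
    have h2 := mul_le_mul_of_nonneg_left (hE (j + 1) hj) hs.1
    linarith

end Scheme

end RandEuler

/-! ### Measurability of the supremum error -/

namespace RandEuler

/-- By continuity the supremum may be taken over a countable dense subset of `A`. -/
lemma measurable_biSup_of_continuousOn {X Ω : Type*} [TopologicalSpace X]
    [SecondCountableTopology X] [MeasurableSpace Ω] {A : Set X}
    {F : X → Ω → ℝ≥0∞} (hc : ∀ ω, ContinuousOn (fun t => F t ω) A)
    (hm : ∀ t ∈ A, Measurable (F t)) : Measurable fun ω => ⨆ t ∈ A, F t ω := by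
  obtain ⟨D, hDc, hDd⟩ := TopologicalSpace.exists_countable_dense A
  have h : (fun ω => ⨆ t ∈ A, F t ω) = fun ω => ⨆ t ∈ D, F (t : X) ω := by
    funext ω
    rw [iSup_subtype']
    refine le_antisymm (iSup_le fun t => ?_)
      (iSup₂_le fun t _ => le_iSup (fun t : A => F t ω) t)
    have hcl : IsClosed {t : A | F t ω ≤ ⨆ s ∈ D, F (s : X) ω} :=
      isClosed_le (continuousOn_iff_continuous_domRestrict.1 (hc ω)) continuous_const
    have hsub : D ⊆ {t : A | F t ω ≤ ⨆ s ∈ D, F (s : X) ω} := fun s hs =>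
      le_iSup₂ (f := fun (s : A) (_ : s ∈ D) => F (s : X) ω) s hs
    exact hcl.closure_subset_iff.2 hsub (hDd t)
  rw [h]
  exact Measurable.biSup D hDc fun t _ => hm t t.2

section Measurability

variable {a b ϱ K L R δ : ℝ} {d : ℕ} {η η' : Vec d} {f f' e : ℝ → Vec d → Vec d}
  {z : ℝ → Vec d} {n : ℕ}

/-- The field is controlled only for times in [a,b]; projecting the time gives joint measurability
everywhere and changes nothing at evaluation points in [a,b]. -/
lemma measurable_projIcc_field (hab : a ≤ b) (H : IVPClass a b ϱ K L R η f)
    (he : NoiseClass a b δ e) (hf : ∀ t ∈ Icc a b, ∀ y, f' t y = f t y + e t y) :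
    Measurable fun q : ℝ × Vec d => f' (projIcc a b hab q.1) q.2 := by
  have h1 : Continuous fun q : ℝ × Vec d => ((projIcc a b hab q.1 : ℝ), q.2) := by fun_prop
  have h2 : ∀ q : ℝ × Vec d, ((projIcc a b hab q.1 : ℝ), q.2) ∈
      Icc a b ×ˢ (univ : Set (Vec d)) := fun q => ⟨(projIcc a b hab q.1).2, mem_univ _⟩
  have h3 : Measurable fun q : ℝ × Vec d => f (projIcc a b hab q.1) q.2 :=
    (H.continuousOn.comp_continuous h1 h2).measurable
  have h4 : Measurable fun q : ℝ × Vec d => e (projIcc a b hab q.1) q.2 :=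
    he.measurable.comp (h1.measurable.subtype_mk (h := h2))
  have h5 : (fun q : ℝ × Vec d => f' (projIcc a b hab q.1) q.2) = fun q : ℝ × Vec d =>
      f (projIcc a b hab q.1) q.2 + e (projIcc a b hab q.1) q.2 :=
    funext fun q => hf _ (projIcc a b hab q.1).2 _
  rw [h5]
  exact h3.add h4

lemma measurable_eulerSeq {Ω : Type*} [MeasurableSpace Ω] {g : ℝ → Vec d → Vec d}
    (hg : Measurable fun q : ℝ × Vec d => g q.1 q.2) {τ : ℕ → Ω → ℝ}
    (hτ : ∀ j ∈ Finset.Icc 1 n, Measurable (τ j)) {j : ℕ} (hj : j ≤ n) :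
    Measurable fun ω => eulerSeq a b n η' g (fun j => τ j ω) j := by
  induction j with
  | zero => exact measurable_const
  | succ j ih =>
    have ih := ih (by omega)
    have h1 := hτ (j + 1) (by simp; omega)
    have h2 : Measurable fun ω => evalPoint a b n (fun j => τ j ω) (j + 1) :=
      (h1.mul_const _).const_add _
    exact ih.add ((hg.comp (h2.prodMk ih)).const_smul (step a b n))

lemma eulerSeq_congr {g : ℝ → Vec d → Vec d} {τ : ℕ → ℝ} {j : ℕ}
    (h : ∀ i < j, ∀ y, f' (evalPoint a b n τ (i + 1)) y = g (evalPoint a b n τ (i + 1)) y) :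
    eulerSeq a b n η' f' τ j = eulerSeq a b n η' g τ j := by
  induction j with
  | zero => rfl
  | succ j ih => rw [eulerSeq, eulerSeq, ih fun i hi => h i (by omega), h j (by omega)]

lemma supError_congr {g : ℝ → Vec d → Vec d} {τ : ℕ → ℝ}
    (h : ∀ i < n, ∀ y, f' (evalPoint a b n τ (i + 1)) y = g (evalPoint a b n τ (i + 1)) y) :
    supError a b z (eulerApprox a b n η' f' τ) = supError a b z (eulerApprox a b n η' g τ) := by
  have h1 : ∀ j ≤ n, eulerSeq a b n η' f' τ j = eulerSeq a b n η' g τ j := fun j hj =>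
    eulerSeq_congr fun i hi => h i (by omega)
  have h2 : eulerApprox a b n η' f' τ = eulerApprox a b n η' g τ := by
    funext t
    rw [eulerApprox, eulerApprox, eulerPiece, eulerPiece, h1 _ (min_le_right _ _),
      h1 _ ((Nat.sub_le _ _).trans (min_le_right _ _))]
  rw [h2]

lemma measurable_supError {Ω : Type*} [MeasurableSpace Ω] {g : ℝ → Vec d → Vec d}
    (hg : Measurable fun q : ℝ × Vec d => g q.1 q.2) (hz : ContinuousOn z (Icc a b))
    {τ : ℕ → Ω → ℝ} (hτ : ∀ j ∈ Finset.Icc 1 n, Measurable (τ j)) :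
    Measurable fun ω => supError a b z (eulerApprox a b n η' g (fun j => τ j ω)) := by
  -- On `A k` a single affine piece is active, so continuity in `t` holds there without matching the
  -- pieces at the grid points.
  let A : ℕ → Set ℝ := fun k =>
    {t | t ∈ Icc a b ∧ min (⌊(t - a) / step a b n⌋₊ + 1) n = k}
  have h : (fun ω => supError a b z (eulerApprox a b n η' g (fun j => τ j ω))) = fun ω =>
      ⨆ k ∈ Iic n, ⨆ t ∈ A k, ‖z t - eulerPiece a b n η' g (fun j => τ j ω) k t‖ₑ := by
    funext ω
    refine le_antisymm (iSup₂_le fun t ht => ?_)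
      (iSup₂_le fun k _ => iSup₂_le fun t ht => ?_)
    · exact le_iSup₂_of_le (min (⌊(t - a) / step a b n⌋₊ + 1) n) (mem_Iic.2 (min_le_right _ _))
        (le_iSup₂_of_le t ⟨ht, rfl⟩ le_rfl)
    · refine le_iSup₂_of_le t ht.1 ?_
      rw [eulerApprox, ht.2]
  rw [h]
  refine Measurable.biSup _ (to_countable _) fun k hk => ?_
  refine measurable_biSup_of_continuousOn (fun ω => ?_) fun t _ => ?_
  · refine ContinuousOn.enorm ((hz.mono fun t ht => ht.1).sub (Continuous.continuousOn ?_))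
    unfold eulerPiece
    fun_prop
  · have h1 := measurable_eulerSeq (a := a) (b := b) (η' := η') hg hτ (mem_Iic.1 hk)
    have h2 := measurable_eulerSeq (a := a) (b := b) (η' := η') hg hτ
      ((Nat.sub_le k 1).trans (mem_Iic.1 hk))
    have h3 : Measurable fun ω => eulerPiece a b n η' g (fun j => τ j ω) k t :=
      ((h1.sub h2).const_smul ((t - node a b n (k - 1)) / step a b n)).add h2
    exact (h3.const_sub (z t)).enorm

end Measurability

/-! ### Moments of the accumulated quadrature error -/

section Uniform

variable {Ω : Type*} [MeasurableSpace Ω] {P : Measure Ω}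

lemma volume_cond_Ioo_zero_one :
    ProbabilityTheory.cond (volume : Measure ℝ) (Ioo (0 : ℝ) 1) =
      volume.restrict (Ioo (0 : ℝ) 1) := by
  simp [ProbabilityTheory.cond]

lemma ae_mem_Icc_of_isUniform {τ : Ω → ℝ} (hm : Measurable τ)
    (hu : pdf.IsUniform τ (Ioo (0 : ℝ) 1) P volume) : ∀ᵐ ω ∂P, τ ω ∈ Icc (0 : ℝ) 1 := by
  refine ae_of_ae_map (p := fun u => u ∈ Icc (0 : ℝ) 1) hm.aemeasurable ?_
  rw [show Measure.map τ P = _ from hu, volume_cond_Ioo_zero_one]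
  filter_upwards [ae_restrict_mem measurableSet_Ioo] with u hu using Ioo_subset_Icc_self hu

lemma integral_comp_of_isUniform {E : Type*} [NormedAddCommGroup E] [NormedSpace ℝ E]
    {τ : Ω → ℝ} (hm : Measurable τ)
    (hu : pdf.IsUniform τ (Ioo (0 : ℝ) 1) P volume) {φ : ℝ → E} (hφ : Continuous φ) :
    ∫ ω, φ (τ ω) ∂P = ∫ u in (0 : ℝ)..1, φ u := by
  rw [intervalIntegral.integral_of_le zero_le_one, integral_Ioc_eq_integral_Ioo,
    ← volume_cond_Ioo_zero_one, ← show Measure.map τ P = _ from hu,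
    integral_map hm.aemeasurable hφ.aestronglyMeasurable]

end Uniform

section Noise

variable {a b ϱ K L R : ℝ} {d : ℕ} {η : Vec d} {f : ℝ → Vec d → Vec d} {z : ℝ → Vec d} {n : ℕ}

lemma IVPClass.continuous_quadError (H : IVPClass a b ϱ K L R η f) (hab : a < b) {j : ℕ}
    (hj : j < n) : Continuous (quadError a b n f z j) :=
  continuous_const.sub (H.continuous_frozenField hab hj)

lemma IVPClass.integral_quadError (H : IVPClass a b ϱ K L R η f) (hab : a < b) {j : ℕ}
    (hj : j < n) : ∫ u in (0 : ℝ)..1, quadError a b n f z j u = 0 := by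
  simp only [quadError]
  rw [intervalIntegral.integral_sub intervalIntegrable_const
    ((H.continuous_frozenField hab hj).intervalIntegrable _ _)]
  simp

/-- The bound for the accumulated quadrature error in terms of reflected walks. -/
noncomputable def noiseBound (a b : ℝ) (n : ℕ) {d : ℕ} (f : ℝ → Vec d → Vec d) (z : ℝ → Vec d)
    (τ : ℕ → ℝ) : ℝ :=
  step a b n * ∑ k, (reflectedWalk (fun j => quadError a b n f z (j - 1) (τ j) k) n +
    reflectedWalk (fun j => -quadError a b n f z (j - 1) (τ j) k) n)

lemma sum_range_succ_eq_sum_Ioc (x : ℕ → ℝ) (j : ℕ) :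
    ∑ i ∈ Finset.range j, x (i + 1) = ∑ i ∈ Finset.Ioc 0 j, x i := by
  induction j with
  | zero => simp
  | succ j ih => rw [Finset.sum_range_succ, Finset.sum_Ioc_succ_top (Nat.zero_le j), ih]

lemma norm_sum_quadError_le (hab : a < b) (hn : 0 < n) (τ : ℕ → ℝ) {j : ℕ} (hj : j ≤ n) :
    ‖∑ i ∈ Finset.range j, step a b n • quadError a b n f z i (τ (i + 1))‖ ≤
      noiseBound a b n f z τ := by
  have hh := step_pos hab hn
  rw [← Finset.smul_sum, norm_smul, Real.norm_of_nonneg hh.le, noiseBound]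
  refine mul_le_mul_of_nonneg_left ?_ hh.le
  rw [PiLp.norm_eq_of_L1]
  refine Finset.sum_le_sum fun k _ => ?_
  have h := abs_sum_Ioc_le_reflectedWalk (fun j => quadError a b n f z (j - 1) (τ j) k) hj
  rw [← sum_range_succ_eq_sum_Ioc] at h
  simpa using h

variable {Ω : Type*} [MeasurableSpace Ω] {P : Measure Ω} {τ : ℕ → Ω → ℝ}

lemma IVPClass.measurable_quadError_comp (H : IVPClass a b ϱ K L R η f) (hab : a < b)
    (hτ : ∀ j ∈ Finset.Icc 1 n, Measurable (τ j)) (k : Fin d) :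
    ∀ j ∈ Finset.Icc 1 n, Measurable fun ω => quadError a b n f z (j - 1) (τ j ω) k := by
  intro j hj
  have hj' := Finset.mem_Icc.1 hj
  have h1 : Continuous fun u => quadError a b n f z (j - 1) u k :=
    (PiLp.continuous_apply 1 (fun _ : Fin d => ℝ) k).comp
      (H.continuous_quadError hab (by omega))
  exact h1.measurable.comp (hτ j hj)

lemma eLpNorm_add_le_ofReal {p : ℝ≥0∞} (hp : 1 ≤ p) {f g : Ω → ℝ}
    (hf : AEStronglyMeasurable f P) (hg : AEStronglyMeasurable g P) {c c' : ℝ} (hc : 0 ≤ c)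
    (hc' : 0 ≤ c') (h : eLpNorm f p P ≤ ENNReal.ofReal c) (h' : eLpNorm g p P ≤ ENNReal.ofReal c') :
    eLpNorm (fun ω => f ω + g ω) p P ≤ ENNReal.ofReal (c + c') := by
  rw [ENNReal.ofReal_add hc hc']
  exact (eLpNorm_add_le hf hg hp).trans (add_le_add h h')

lemma eLpNorm_const_mul_le_ofReal {p : ℝ≥0∞} {f : Ω → ℝ} {r c : ℝ} (hr : 0 ≤ r)
    (h : eLpNorm f p P ≤ ENNReal.ofReal c) :
    eLpNorm (fun ω => r * f ω) p P ≤ ENNReal.ofReal (r * c) := by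
  rw [ENNReal.ofReal_mul hr]
  refine (eLpNorm_const_smul_le (c := r) (f := f)).trans ?_
  rw [Real.enorm_of_nonneg hr]
  gcongr

lemma IVPClass.aestronglyMeasurable_noiseBound (H : IVPClass a b ϱ K L R η f) (hab : a < b)
    (hτ : ∀ j ∈ Finset.Icc 1 n, Measurable (τ j)) :
    AEStronglyMeasurable (fun ω => noiseBound a b n f z (fun j => τ j ω)) P := by
  have h := fun k => H.measurable_quadError_comp (z := z) hab hτ k
  refine Measurable.aestronglyMeasurable (Measurable.const_mul (Finset.measurable_fun_sum _
    fun k _ => ?_) _)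
  exact (measurable_reflectedWalk (h k)).add (measurable_reflectedWalk fun j hj => (h k j hj).neg)

variable [IsProbabilityMeasure P]

/-- The uniform law turns the mean of an increment into the integral of `quadError` over [0,1],
which is zero. The sign `s` covers both walks. -/
lemma IVPClass.eLpNorm_reflectedWalk_quadError_le (H : IVPClass a b ϱ K L R η f) (hab : a < b)
    (hK : 0 < K) (hL : 0 < L) (hϱ : 0 ≤ ϱ) (hR : solBound K (b - a) + K ≤ R)
    (hz : IsSolution a b η f z) (hn : 0 < n) {p : ℝ} (hp : 0 < p)
    (hτ : ∀ j ∈ Finset.Icc 1 n, Measurable (τ j))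
    (hu : ∀ j ∈ Finset.Icc 1 n, pdf.IsUniform (τ j) (Ioo (0 : ℝ) 1) P volume)
    (hi : iIndepFun (fun j : Finset.Icc 1 n => τ j) P) (k : Fin d) (s : ℝ) (hs : |s| = 1) :
    eLpNorm (fun ω => reflectedWalk (fun j => s * quadError a b n f z (j - 1) (τ j ω) k) n)
      (ENNReal.ofReal p) P ≤
      ENNReal.ofReal (walkConst p * (L * step a b n ^ ϱ * √n)) := by
  have hh := step_pos hab hn
  have hc : ∀ j ∈ Finset.Icc 1 n, Continuous fun u => s * quadError a b n f z (j - 1) u k := by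
    intro j hj
    have hj' := Finset.mem_Icc.1 hj
    exact continuous_const.mul ((PiLp.continuous_apply 1 (fun _ : Fin d => ℝ) k).comp
      (H.continuous_quadError hab (by omega)))
  refine eLpNorm_reflectedWalk_le
    (X := fun j ω => s * quadError a b n f z (j - 1) (τ j ω) k) hp hn (by positivity)
    (fun j hj => (hc j hj).measurable.comp (hτ j hj)) (fun j hj ω => ?_) (fun j hj => ?_) ?_
  · have hj' := Finset.mem_Icc.1 hj
    rw [abs_mul, hs, one_mul, ← Real.norm_eq_abs]
    exact (PiLp.norm_apply_le _ k).trans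
      (H.norm_quadError_le hab hK hL.le hϱ hR hz (by omega) _)
  · have hj' := Finset.mem_Icc.1 hj
    have hjn : j - 1 < n := by omega
    rw [integral_comp_of_isUniform (φ := fun u => s * quadError a b n f z (j - 1) u k)
      (hτ j hj) (hu j hj) (hc j hj), intervalIntegral.integral_const_mul]
    have h1 := (PiLp.proj (𝕜 := ℝ) 1 (fun _ : Fin d => ℝ) k).intervalIntegral_comp_comm
      ((H.continuous_quadError (z := z) hab hjn).intervalIntegrable (μ := volume) 0 1)
    simp only [PiLp.proj_apply] at h1
    rw [h1, H.integral_quadError hab hjn]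
    simp
  · exact hi.comp (fun (j : Finset.Icc 1 n) u => s * quadError a b n f z (j - 1) u k)
      fun j => (hc j j.2).measurable

lemma IVPClass.eLpNorm_noiseBound_le (H : IVPClass a b ϱ K L R η f) (hab : a < b)
    (hK : 0 < K) (hL : 0 < L) (hϱ : 0 ≤ ϱ) (hR : solBound K (b - a) + K ≤ R)
    (hz : IsSolution a b η f z) (hn : 0 < n) {p : ℝ} (hp : 1 ≤ p)
    (hτ : ∀ j ∈ Finset.Icc 1 n, Measurable (τ j))
    (hu : ∀ j ∈ Finset.Icc 1 n, pdf.IsUniform (τ j) (Ioo (0 : ℝ) 1) P volume)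
    (hi : iIndepFun (fun j : Finset.Icc 1 n => τ j) P) :
    eLpNorm (fun ω => noiseBound a b n f z (fun j => τ j ω)) (ENNReal.ofReal p) P ≤
      ENNReal.ofReal (2 * d * walkConst p * L * √(b - a) * step a b n ^ (ϱ + 1 / 2)) := by
  have hh := step_pos hab hn
  have hp' : 1 ≤ ENNReal.ofReal p := by simpa using ENNReal.ofReal_le_ofReal hp
  have hW : 0 ≤ walkConst p := by unfold walkConst; positivity
  have hm := fun k => H.measurable_quadError_comp (z := z) hab hτ k
  set B := walkConst p * (L * step a b n ^ ϱ * √n) with hB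
  have hB0 : 0 ≤ B := by positivity
  have hpair : ∀ k : Fin d, eLpNorm (fun ω =>
      reflectedWalk (fun j => quadError a b n f z (j - 1) (τ j ω) k) n +
      reflectedWalk (fun j => -quadError a b n f z (j - 1) (τ j ω) k) n) (ENNReal.ofReal p) P ≤
      ENNReal.ofReal (B + B) := by
    intro k
    refine eLpNorm_add_le_ofReal hp' (measurable_reflectedWalk (hm k)).aestronglyMeasurable
      (measurable_reflectedWalk fun j hj => (hm k j hj).neg).aestronglyMeasurable hB0 hB0 ?_ ?_
    · simpa using H.eLpNorm_reflectedWalk_quadError_le hab hK hL hϱ hR hz hn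
        (by linarith) hτ hu hi k 1 (by simp)
    · simpa using H.eLpNorm_reflectedWalk_quadError_le hab hK hL hϱ hR hz hn
        (by linarith) hτ hu hi k (-1) (by simp)
  have hsum : eLpNorm (fun ω => ∑ k : Fin d,
      (reflectedWalk (fun j => quadError a b n f z (j - 1) (τ j ω) k) n +
      reflectedWalk (fun j => -quadError a b n f z (j - 1) (τ j ω) k) n)) (ENNReal.ofReal p) P ≤
      ENNReal.ofReal (d * (B + B)) := by
    have h1 := eLpNorm_sum_le (μ := P) (p := ENNReal.ofReal p) (s := Finset.univ)
      (f := fun (k : Fin d) ω =>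
        reflectedWalk (fun j => quadError a b n f z (j - 1) (τ j ω) k) n +
        reflectedWalk (fun j => -quadError a b n f z (j - 1) (τ j ω) k) n)
      (fun k _ => ((measurable_reflectedWalk (hm k)).add
        (measurable_reflectedWalk fun j hj => (hm k j hj).neg)).aestronglyMeasurable) hp'
    have h2 := h1.trans (Finset.sum_le_sum fun k _ => hpair k)
    rw [Finset.sum_const, Finset.card_univ, Fintype.card_fin, nsmul_eq_mul] at h2
    rw [ENNReal.ofReal_mul (by positivity), ENNReal.ofReal_natCast]
    rwa [Finset.sum_fn] at h2
  refine (eLpNorm_const_mul_le_ofReal hh.le hsum).trans (le_of_eq ?_)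
  -- Since nh = b - a, the factor h√n is worth √(b-a)·h^(1/2): this is the gain of one half from
  -- randomization.
  have hsq : step a b n * √n = √(b - a) * step a b n ^ (1 / 2 : ℝ) := by
    rw [← Real.sqrt_eq_rpow, ← nat_mul_step (a := a) (b := b) hn,
      Real.sqrt_mul (by positivity), mul_assoc, Real.mul_self_sqrt hh.le, mul_comm]
  congr 1
  rw [Real.rpow_add hh, hB]
  linear_combination (2 * d * walkConst p * L * step a b n ^ ϱ) * hsq

end Noise

end RandEuler

/-! ### Assembly of the error bound -/

theorem theorem3p3 (a b : ℝ) (hab : a < b) (d : ℕ) (hd : 0 < d)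
    (K L ϱ p : ℝ) (hK : 0 < K) (hL : 0 < L) (hϱ₀ : 0 < ϱ) (hϱ₁ : ϱ ≤ 1) (hp : 2 ≤ p) :
    ∃ C : ℝ, 0 < C ∧
      ∀ (η : RandEuler.Vec d) (f : ℝ → RandEuler.Vec d → RandEuler.Vec d),
        RandEuler.IVPClass a b ϱ K L (RandEuler.radius₀ a b K) η f →
        ∃ z : ℝ → RandEuler.Vec d,
          RandEuler.IsSolution a b η f z ∧
          (∀ w : ℝ → RandEuler.Vec d, RandEuler.IsSolution a b η f w → EqOn w z (Icc a b)) ∧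
          ∀ (n : ℕ), ⌊b - a⌋₊ + 1 ≤ n →
          ∀ (δ : ℝ), δ ∈ Icc (0 : ℝ) 1 →
          ∀ (η' : RandEuler.Vec d) (f' : ℝ → RandEuler.Vec d → RandEuler.Vec d),
            RandEuler.InexactInfo a b δ η f η' f' →
          ∀ (Ω : Type*) [MeasurableSpace Ω] (P : Measure Ω) [IsProbabilityMeasure P]
            (τ : ℕ → Ω → ℝ),
            (∀ j ∈ Finset.Icc 1 n, Measurable (τ j)) →
            (∀ j ∈ Finset.Icc 1 n, pdf.IsUniform (τ j) (Ioo (0 : ℝ) 1) P volume) →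
            iIndepFun (fun j : Finset.Icc 1 n => τ j) P →
            AEMeasurable (fun ω => RandEuler.supError a b z
              (RandEuler.eulerApprox a b n η' f' (fun j => τ j ω))) P ∧
            eLpNorm (fun ω => RandEuler.supError a b z
              (RandEuler.eulerApprox a b n η' f' (fun j => τ j ω))) (ENNReal.ofReal p) P ≤
              ENNReal.ofReal (C * (RandEuler.step a b n ^ min (ϱ + 1 / 2) 1 + δ)) := by
  have hT : 0 < b - a := sub_pos.2 hab
  have hR := RandEuler.solBound_add_le_radius₀ hK hab
  have hR' := RandEuler.schemeBound_sub_le_radius₀ (a := a) (b := b) (K := K)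
  set X := Real.exp (L * (b - a)) with hX
  set A := RandEuler.schemeBound K (b - a) with hA
  set M := K * (1 + RandEuler.solBound K (b - a)) with hM
  set W := 2 * d * RandEuler.walkConst p * L * √(b - a) with hW
  have hX0 : 0 < X := Real.exp_pos _
  have hA0 : 0 < A := by rw [hA, RandEuler.schemeBound]; positivity
  have hM0 : 0 < M := by
    have := RandEuler.solBound_pos hK hT.le
    positivity
  have hW0 : 0 ≤ W := by
    have : 0 ≤ RandEuler.walkConst p := by unfold RandEuler.walkConst; positivity
    positivity
  -- The three summands are the coefficients of h^(ϱ+1/2), h and δ when the grid bound is inserted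
  -- into 2Mh + E.
  refine ⟨(1 + X) * W + (2 + X) * M + X * (1 + A / L), by positivity, fun η f H => ?_⟩
  obtain ⟨z, hz⟩ := H.exists_solution hab hK hL.le hR
  refine ⟨z, hz, fun w hw => H.solution_unique hK hL.le hR hz hw, ?_⟩
  rintro n hn δ hδ η' f' ⟨hη, e, he, hf⟩ Ω _ P _ τ hτ hu hi
  have hn0 : 0 < n := by omega
  have hh := RandEuler.step_pos hab hn0
  have hh1 : RandEuler.step a b n ≤ 1 := by
    rw [RandEuler.step, div_le_one (by positivity)]
    refine (Nat.lt_floor_add_one (b - a)).le.trans ?_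
    exact_mod_cast hn
  have hmem : ∀ᵐ ω ∂P, ∀ j < n, τ (j + 1) ω ∈ Icc (0 : ℝ) 1 := by
    refine ae_all_iff.2 fun j => ?_
    by_cases hj : j < n
    · have hj' : j + 1 ∈ Finset.Icc 1 n := by simp; omega
      filter_upwards [RandEuler.ae_mem_Icc_of_isUniform (hτ _ hj') (hu _ hj')] with ω h _ using h
    · exact Filter.Eventually.of_forall fun ω h => absurd h hj
  constructor
  -- The evaluation points lie in [a,b] only almost surely, so the measurable version with projected
  -- time agrees with the error off a null set.
  · refine ⟨_, RandEuler.measurable_supError (η' := η')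
      (g := fun t y => f' (projIcc a b hab.le t) y)
      (RandEuler.measurable_projIcc_field hab.le H he hf)
      (fun t ht => (hz.2 t ht).continuousWithinAt) hτ, ?_⟩
    filter_upwards [hmem] with ω hω
    refine RandEuler.supError_congr fun i hi y => ?_
    rw [projIcc_of_mem hab.le (RandEuler.evalPoint_mem hab hω hi)]
  · have hN := H.eLpNorm_noiseBound_le (p := p) hab hK hL hϱ₀.le hR hz hn0 (by linarith) hτ hu hi
    rw [← hW] at hN
    have hNm := H.aestronglyMeasurable_noiseBound (z := z) (P := P) hab hτ
    set h := RandEuler.step a b n with hhdef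
    set B := (2 + X) * (M * h) + X * (1 + A / L) * δ with hB
    have hB0 : 0 ≤ B := by
      have := hδ.1
      positivity
    have hpt : ∀ᵐ ω ∂P, ‖RandEuler.supError a b z
        (RandEuler.eulerApprox a b n η' f' (fun j => τ j ω))‖ₑ ≤
        ‖B + (1 + X) * RandEuler.noiseBound a b n f z (fun j => τ j ω)‖ₑ := by
      filter_upwards [hmem] with ω hω
      rw [enorm_eq_self]
      refine iSup₂_le fun t ht => ?_
      have h0 := fun j (hj : j ≤ n) => H.norm_node_error_le (τ := fun j => τ j ω) hab hK hL
        hR hR' hz hδ hη he hf hω hn0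
        (fun j hj => RandEuler.norm_sum_quadError_le hab hn0 (fun j => τ j ω) hj) hj
      have h1 := H.norm_sub_eulerApprox_le hab hK hz hn0 h0 ht
      rw [← ofReal_norm, ← ofReal_norm, Real.norm_eq_abs]
      refine ENNReal.ofReal_le_ofReal (h1.trans (le_trans (le_of_eq ?_) (le_abs_self _)))
      rw [hB]
      ring
    refine (eLpNorm_mono_enorm_ae hpt).trans ?_
    have hp1 : 1 ≤ ENNReal.ofReal p := by
      rw [ENNReal.one_le_ofReal]
      linarith
    refine (RandEuler.eLpNorm_add_le_ofReal hp1 aestronglyMeasurable_const (hNm.const_mul (1 + X)) hB0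
      (by positivity) ?_ (RandEuler.eLpNorm_const_mul_le_ofReal (by positivity) hN)).trans ?_
    · rw [eLpNorm_const _ (by simp; linarith) (NeZero.ne P), measure_univ, ENNReal.one_rpow,
        mul_one, Real.enorm_of_nonneg hB0]
    · apply ENNReal.ofReal_le_ofReal
      -- The lower bound on `n` gives h ≤ 1, so both powers of `h` are at most the one with the
      -- smaller exponent.
      have h1 : h ^ (ϱ + 1 / 2) ≤ h ^ min (ϱ + 1 / 2) 1 :=
        Real.rpow_le_rpow_of_exponent_ge hh hh1 (min_le_left _ _)
      have h2 : h ≤ h ^ min (ϱ + 1 / 2) 1 := by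
        conv_lhs => rw [← Real.rpow_one h]
        exact Real.rpow_le_rpow_of_exponent_ge hh hh1 (min_le_right _ _)
      set Q := h ^ min (ϱ + 1 / 2) 1 with hQ
      have hQ0 : 0 ≤ Q := hh.le.trans h2
      have hδ0 := hδ.1
      have h3 : (1 + X) * (W * h ^ (ϱ + 1 / 2)) ≤ (1 + X) * (W * Q) := by gcongr
      have h4 : (2 + X) * (M * h) ≤ (2 + X) * (M * Q) := by gcongr
      have h5 : 0 ≤ ((1 + X) * W + (2 + X) * M) * δ + X * (1 + A / L) * Q := by positivity
      rw [hB]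
      linarith
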